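/- Let $N\ge 0$ and $0\le m\le N$ be integers, let $K$ be a field of characteristic $0$ (for instance $\mathbb R$ or $\mathbb C$) and let $\beta\in K$. Let $z_1,\dots,z_N$ be commuting variables and $\theta_1,\dots,\theta_N$ anticommuting ones ($\theta_i\theta_j=-\theta_j\theta_i$, $\theta_i^2=0$), the $z$'s commuting with the $\theta$'s. The transformed Hamiltonian of the supersymmetric trigonometric Calogero–Moser–Sutherland model is $$\bar{\mathcal H}=\sum_i (z_i\partial_{z_i})^2+\beta\sum_{i<j}\frac{z_i+z_j}{z_i-z_j}\,(z_i\partial_{z_i}-z_j\partial_{z_j})-2\beta\sum_{i<j}\frac{z_iz_j}{(z_i-z_j)^2}\,(1-\kappa_{ij}),\qquad \kappa_{ij}=1-(\theta_i-\theta_j)(\partial_{\theta_i}-\partial_{\theta_j}).$$ A superpartition (of the $m$-fermion sector, with $N$ parts) is a sequence of non-negative integers $\Lambda=(\lambda^a;\lambda^s)=(\Lambda_1,\dots,\Lambda_m;\Lambda_{m+1},\dots,\Lambda_N)$ with $\Lambda_1>\dots>\Lambda_m$ and $\Lambda_{m+1}\ge\dots\ge\Lambda_N$. Let $\Lambda^*$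 be the partition obtained by rearranging all parts of $\Lambda$ in decreasing order, let $n_{\lambda^s}(a)$ be the number of parts of $\lambda^s$ equal to $a$, and put $f_\Lambda=\prod_{a\ge 0} n_{\lambda^s}(a)!$. The monomial superfunction is $$m_\Lambda=\frac1{f_\Lambda}\sum_{\sigma\in S_N}\theta_{\sigma(1)}\cdots\theta_{\sigma(m)}\; z_{\sigma(1)}^{\Lambda_1}\cdots z_{\sigma(N)}^{\Lambda_N}.$$ A pair $(i,j)$ with $i<j$ is of type I if $i,j\le m$, of type II if $i\le m<j$, and of type III if $m<i$; put $\delta=2,1,0$ for the types I, II, III respectively. For $\ell\ge 1$ let $R^{(\ell)}_{ij}\Lambda$ be the sequence obtained from $\Lambda$ by subtracting $\ell$ from the larger and adding $\ell$ to the smaller of the two parts $\Lambda_i,\Lambda_j$; it is defined only if $$\text{I: }\ \left\lfloor\tfrac{\Lambda_i-\Lambda_j-1}2\right\rfloor\ge\ell,\qquad \text{II: }\ |\Lambda_i-\Lambda_j|-1\ge\ell,\qquad \text{III: }\ \left\lfloor\tfrac{\Lambda_i-\Lambda_j}2\right\rfloor\ge\ell .$$ For a sequence $\gamma=(\gamma_1,\dots,\gamma_N)$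 whose first $m$ entries are distinct, let $\overline\gamma$ be the superpartition obtained by rearranging separately the first $m$ and the last $N-m$ entries in decreasing order, and let $\sigma^a_\gamma$ be the permutation of $\{1,\dots,m\}$ that sends $(\gamma_1,\dots,\gamma_m)$ to its rearrangement. **Theorem.** For every superpartition $\Lambda$, $$\bar{\mathcal H}\,m_\Lambda=\varepsilon_\Lambda\, m_\Lambda+\sum_{\Omega\ne\Lambda}v_{\Lambda\Omega}(\beta)\,m_\Omega,\qquad \varepsilon_\Lambda=\sum_{j=1}^N\left[(\Lambda_j^*)^2+\beta(N+1-2j)\Lambda_j^*\right],$$ a finite sum over superpartitions $\Omega=(\omega^a;\omega^s)$ with $N$ parts in the same $m$-fermion sector, where $v_{\Lambda\Omega}(\beta)$ is non-zero only if $\Omega=\overline{R^{(\ell)}_{ij}\Lambda}$ for some $i<j$ and some $\ell>0$. Whenever $\Omega=\overline{R^{(\ell)}_{ij}\Lambda}$ with $i<j$ and $\ell>0$, $$v_{\Lambda\Omega}(\beta)=\begin{cases}2\beta\,\mathrm{sgn}\bigl(\sigma^a_{R^{(\ell)}_{ij}\Lambda}\bigr)(\Lambda_i-\Lambda_j-\delta\ell)\;n(\Lambda_i-\ell,\Lambda_j+\ell)&\text{if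 }\Lambda_i>\Lambda_j,\\[2pt] 2\beta\,\mathrm{sgn}\bigl(\sigma^a_{R^{(\ell)}_{ij}\Lambda}\bigr)(\Lambda_j-\Lambda_i-\delta\ell)\;n(\Lambda_i+\ell,\Lambda_j-\ell)&\text{if }\Lambda_j>\Lambda_i,\end{cases}$$ where $\delta$ belongs to the type of $(i,j)$ and $$n(a,b)=\begin{cases}1&(i,j)\text{ of type I},\\ n_{\omega^s}(b)&(i,j)\text{ of type II},\\ n_{\omega^s}(a)\,n_{\omega^s}(b)&(i,j)\text{ of type III and }a\ne b,\\ \tfrac12 n_{\omega^s}(a)\,(n_{\omega^s}(a)-1)&(i,j)\text{ of type III and }a=b.\end{cases}$$ -/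

import Mathlib

open scoped TensorProduct

noncomputable section

namespace SuperCMS

/-! ### The algebra of superfunctions -/

/-- Rational functions in the commuting variables `z i`, `i : Fin N`, with coefficients in `𝕜`. -/
abbrev RatFun (𝕜 : Type*) [Field 𝕜] (N : ℕ) : Type _ :=
  FractionRing (MvPolynomial (Fin N) 𝕜)

/-- The Grassmann algebra over `𝕜` on the anticommuting variables `θ i`, `i : Fin N`. -/
abbrev Grassmann (𝕜 : Type*) [Field 𝕜] (N : ℕ) : Type _ :=
  ExteriorAlgebra 𝕜 (Fin N → 𝕜)

/-- Superfunctions: rational functions of the `z i` with values in the Grassmann algebra of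
the `θ i`; the `z i` commute with the `θ i`. -/
abbrev SuperFun (𝕜 : Type*) [Field 𝕜] (N : ℕ) : Type _ :=
  RatFun 𝕜 N ⊗[𝕜] Grassmann 𝕜 N

section Operators

variable {𝕜 : Type*} [Field 𝕜] {N : ℕ}

/-- The variable `z i` as a rational function. -/
def z (i : Fin N) : RatFun 𝕜 N :=
  algebraMap (MvPolynomial (Fin N) 𝕜) (RatFun 𝕜 N) (MvPolynomial.X i)

/-- The anticommuting variable `θ i`. -/
def θ (i : Fin N) : Grassmann 𝕜 N :=
  ExteriorAlgebra.ι 𝕜 (Pi.single i (1 : 𝕜))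

/-! #### Partial derivatives of rational functions -/

/-- First-order Taylor expansion of a polynomial in direction `i`: the substitution
`z i ↦ z i + ε`, with values in the dual numbers over the rational functions. -/
def polyTaylor (i : Fin N) : MvPolynomial (Fin N) 𝕜 →ₐ[𝕜] DualNumber (RatFun 𝕜 N) :=
  MvPolynomial.aeval fun j =>
    TrivSqZeroExt.inl (z j) + TrivSqZeroExt.inr (if j = i then (1 : RatFun 𝕜 N) else 0)

theorem fst_polyTaylor (i : Fin N) (p : MvPolynomial (Fin N) 𝕜) :
    (polyTaylor i p).fst = algebraMap _ (RatFun 𝕜 N) p := by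
  have h : (TrivSqZeroExt.fstHom 𝕜 (RatFun 𝕜 N) (RatFun 𝕜 N)).comp (polyTaylor i) =
      IsScalarTower.toAlgHom 𝕜 (MvPolynomial (Fin N) 𝕜) (RatFun 𝕜 N) := by
    apply MvPolynomial.algHom_ext
    intro j
    by_cases h : j = i <;> simp [polyTaylor, z, h]
  exact DFunLike.congr_fun h p

theorem isUnit_polyTaylor (i : Fin N) (p : nonZeroDivisors (MvPolynomial (Fin N) 𝕜)) :
    IsUnit (polyTaylor i (p : MvPolynomial (Fin N) 𝕜)) := by
  rw [TrivSqZeroExt.isUnit_iff_isUnit_fst, fst_polyTaylor]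
  exact IsLocalization.map_units (RatFun 𝕜 N) p

/-- First-order Taylor expansion of a rational function: the extension of `polyTaylor` to
the field of fractions. -/
def taylor (i : Fin N) : RatFun 𝕜 N →ₐ[𝕜] DualNumber (RatFun 𝕜 N) :=
  IsLocalization.liftAlgHom (M := nonZeroDivisors (MvPolynomial (Fin N) 𝕜))
    (f := polyTaylor i) (isUnit_polyTaylor i)

theorem taylor_algebraMap (i : Fin N) (p : MvPolynomial (Fin N) 𝕜) :
    taylor i (algebraMap _ (RatFun 𝕜 N) p) = polyTaylor i p :=
  IsLocalization.lift_eq _ p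

theorem fst_taylor (i : Fin N) (f : RatFun 𝕜 N) : (taylor i f).fst = f := by
  have h : ((TrivSqZeroExt.fstHom 𝕜 (RatFun 𝕜 N) (RatFun 𝕜 N)).comp (taylor i)).toRingHom =
      RingHom.id (RatFun 𝕜 N) := by
    apply IsLocalization.ringHom_ext (nonZeroDivisors (MvPolynomial (Fin N) 𝕜))
    refine RingHom.ext fun p => ?_
    simp [taylor_algebraMap, fst_polyTaylor]
  exact DFunLike.congr_fun h f

/-- The partial derivative `∂/∂z_i` on rational functions: the coefficient of `ε` in the
expansion of `f (z + ε e_i)`. -/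
def partialZ (i : Fin N) : RatFun 𝕜 N →ₗ[𝕜] RatFun 𝕜 N :=
  (TrivSqZeroExt.sndHom (RatFun 𝕜 N) (RatFun 𝕜 N)).restrictScalars 𝕜 ∘ₗ (taylor i).toLinearMap

/-- `partialZ` satisfies the Leibniz rule. -/
theorem partialZ_mul (i : Fin N) (f g : RatFun 𝕜 N) :
    partialZ i (f * g) = f * partialZ i g + g * partialZ i f := by
  simp [partialZ, fst_taylor, mul_comm]

/-- `partialZ` extends the partial derivative of polynomials. -/
theorem partialZ_algebraMap (i : Fin N) (p : MvPolynomial (Fin N) 𝕜) :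
    partialZ i (algebraMap _ (RatFun 𝕜 N) p) =
      algebraMap _ (RatFun 𝕜 N) (MvPolynomial.pderiv i p) := by
  induction p using MvPolynomial.induction_on with
  | C a =>
    rw [← MvPolynomial.algebraMap_eq 𝕜 (Fin N)]
    simp [partialZ, taylor_algebraMap, TrivSqZeroExt.algebraMap_eq_inl']
  | add p q hp hq => simp [hp, hq]
  | mul_X p j hp =>
    have hX : partialZ i (algebraMap (MvPolynomial (Fin N) 𝕜) (RatFun 𝕜 N) (MvPolynomial.X j)) =
        algebraMap (MvPolynomial (Fin N) 𝕜) (RatFun 𝕜 N)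
          (MvPolynomial.pderiv i (MvPolynomial.X j)) := by
      by_cases h : j = i
      · subst h
        simp [partialZ, taylor_algebraMap, polyTaylor]
      · simp [partialZ, taylor_algebraMap, polyTaylor, h, MvPolynomial.pderiv_X]
    simp only [map_mul, partialZ_mul, hp, hX, Derivation.leibniz, map_add, smul_eq_mul]

/-! #### Operators on superfunctions -/

/-- Multiplication of superfunctions by the rational function `f`. -/
def mulZ (f : RatFun 𝕜 N) : Module.End 𝕜 (SuperFun 𝕜 N) :=
  LinearMap.rTensor (Grassmann 𝕜 N) (LinearMap.mulLeft 𝕜 f)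

/-- The operator `z_i ∂/∂z_i` on superfunctions. -/
def euler (i : Fin N) : Module.End 𝕜 (SuperFun 𝕜 N) :=
  LinearMap.rTensor (Grassmann 𝕜 N) (LinearMap.mulLeft 𝕜 (z i) ∘ₗ partialZ i)

/-- The operator `∂/∂θ_i` on the Grassmann algebra: the antiderivation with
`∂θ_j/∂θ_i = δ_{ij}` (left contraction with the `i`-th coordinate form). -/
def partialθ (i : Fin N) : Module.End 𝕜 (Grassmann 𝕜 N) :=
  CliffordAlgebra.contractLeft (LinearMap.proj i)

/-- The fermionic exchange operator
`κ_{ij} = 1 - (θ_i - θ_j) (∂/∂θ_i - ∂/∂θ_j)` on superfunctions. -/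
def κ (i j : Fin N) : Module.End 𝕜 (SuperFun 𝕜 N) :=
  1 - LinearMap.lTensor (RatFun 𝕜 N)
    (LinearMap.mulLeft 𝕜 (θ i - θ j : Grassmann 𝕜 N) ∘ₗ (partialθ i - partialθ j))

/-- The operator `(z_i + z_j) / (z_i - z_j) (z_i ∂/∂z_i - z_j ∂/∂z_j)`. -/
def pairB (i j : Fin N) : Module.End 𝕜 (SuperFun 𝕜 N) :=
  mulZ ((z i + z j) / (z i - z j)) * (euler i - euler j)

/-- The operator `z_i z_j / (z_i - z_j)² (1 - κ_{ij})`. -/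
def pairF (i j : Fin N) : Module.End 𝕜 (SuperFun 𝕜 N) :=
  mulZ (z i * z j / (z i - z j) ^ 2) * (1 - κ i j)

/-- The transformed Hamiltonian of the supersymmetric trigonometric
Calogero-Moser-Sutherland model, in the variables `z_j = exp (2πi x_j / L)`:
`∑_i (z_i ∂_i)² + β ∑_{i<j} (z_i + z_j) / (z_i - z_j) (z_i ∂_i - z_j ∂_j)
  - 2 β ∑_{i<j} z_i z_j / (z_i - z_j)² (1 - κ_{ij})`. -/
def hamiltonian (β : 𝕜) : Module.End 𝕜 (SuperFun 𝕜 N) :=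
  (∑ i : Fin N, euler i ^ 2)
    + β • (∑ i : Fin N, ∑ j ∈ Finset.Ioi i, pairB i j)
    - (2 * β) • (∑ i : Fin N, ∑ j ∈ Finset.Ioi i, pairF i j)

end Operators

/-! ### Superpartitions -/

/-- Superpartitions with `N` parts in the `m`-fermion sector: the first `m` parts are strictly
decreasing, the last `N - m` parts are weakly decreasing. -/
@[ext]
structure Superpartition (N m : ℕ) where
  /-- The parts, indexed from `0`. -/
  parts : Fin N → ℕ
  m_le : m ≤ N
  anti : ∀ i j : Fin N, i < j → (j : ℕ) < m → parts j < parts i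
  symm : ∀ i j : Fin N, m ≤ (i : ℕ) → i ≤ j → parts j ≤ parts i

namespace Superpartition

variable {N m : ℕ}

/-- The partition `Λ^*`: the parts of `Λ` rearranged in decreasing order. -/
def star (Λ : Superpartition N m) : Fin N → ℕ :=
  Λ.parts ∘ Tuple.sort (fun k => OrderDual.toDual (Λ.parts k))

/-- The number `n_{λ^s}(a)` of parts equal to `a` in the symmetric part of `Λ`. -/
def mult (Λ : Superpartition N m) (a : ℕ) : ℕ :=
  (Finset.univ.filter fun k : Fin N => m ≤ (k : ℕ) ∧ Λ.parts k = a).card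

/-- The normalization constant `f_Λ = ∏_a n_{λ^s}(a)!` (values `a` that do not occur among
the parts contribute the factor `0! = 1`). -/
def norm (Λ : Superpartition N m) : ℕ :=
  ∏ a ∈ Finset.univ.image Λ.parts, (Λ.mult a).factorial

/-- The eigenvalue `ε_Λ = ∑_j ((Λ^*_j)² + β (N + 1 - 2 j) Λ^*_j)`, `j = 1, …, N`. -/
def eigenvalue {𝕜 : Type*} [Field 𝕜] (β : 𝕜) (Λ : Superpartition N m) : 𝕜 :=
  ∑ j : Fin N, ((Λ.star j : 𝕜) ^ 2 +
    β * ((N : 𝕜) + 1 - 2 * (((j : ℕ) : 𝕜) + 1)) * (Λ.star j : 𝕜))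

/-- The term `𝒦_σ (θ_1 ⋯ θ_m z^Λ) = θ_{σ(1)} ⋯ θ_{σ(m)} ∏_k z_{σ(k)}^{Λ_k}`. -/
def term (𝕜 : Type*) [Field 𝕜] (Λ : Superpartition N m) (σ : Equiv.Perm (Fin N)) :
    SuperFun 𝕜 N :=
  (∏ k : Fin N, (z (σ k) : RatFun 𝕜 N) ^ Λ.parts k) ⊗ₜ[𝕜]
    (List.ofFn fun k : Fin m => (θ (σ (Fin.castLE Λ.m_le k)) : Grassmann 𝕜 N)).prod

/-- The monomial symmetric superfunction `m_Λ = (1 / f_Λ) ∑_σ 𝒦_σ (θ_1 ⋯ θ_m z^Λ)`. -/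
def monomial (𝕜 : Type*) [Field 𝕜] (Λ : Superpartition N m) : SuperFun 𝕜 N :=
  (Λ.norm : 𝕜)⁻¹ • ∑ σ : Equiv.Perm (Fin N), Λ.term 𝕜 σ

end Superpartition

/-! ### Two-part lowering operators -/

/-- The three types of pairs `(i, j)` with `i < j`. -/
inductive PairType
  | I
  | II
  | III

/-- The type of a pair `(i, j)` with `i < j`: type `I` if both indices belong to the
antisymmetric side (the first `m` positions), type `II` if only `i` does, type `III` if none
does. -/
def pairType {N : ℕ} (m : ℕ) (i j : Fin N) : PairType :=
  if (j : ℕ) < m then .I else if (i : ℕ) < m then .II else .III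

/-- The parameter `δ`. -/
def PairType.delta : PairType → ℕ
  | .I => 2
  | .II => 1
  | .III => 0

/-- The condition under which the lowering operator of intensity `ℓ` does not annihilate a
superpartition with parts `a` and `b` in positions `i < j` forming a pair of the given type. -/
def PairType.Admissible (a b ℓ : ℕ) : PairType → Prop
  | .I => ((a : ℤ) - b - 1) / 2 ≥ ℓ
  | .II => |(a : ℤ) - b| - 1 ≥ ℓ
  | .III => ((a : ℤ) - b) / 2 ≥ ℓ

open Classical in
/-- The lowering operator `R_{ij}^{(ℓ)}` for `i < j`; the value `none` means that `Λ` is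
annihilated. -/
def lowering {N m : ℕ} (i j : Fin N) (ℓ : ℕ) (Λ : Superpartition N m) :
    Option (Fin N → ℕ) :=
  if (pairType m i j).Admissible (Λ.parts i) (Λ.parts j) ℓ then
    if Λ.parts j < Λ.parts i then
      some (Function.update (Function.update Λ.parts i (Λ.parts i - ℓ)) j (Λ.parts j + ℓ))
    else if Λ.parts i < Λ.parts j then
      some (Function.update (Function.update Λ.parts i (Λ.parts i + ℓ)) j (Λ.parts j - ℓ))
    else some Λ.parts
  else none

/-- `Ω` is the rearrangement `γ̄` of the sequence `γ`, and `σᵃ`, `σˢ` are permutations of the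
first `m` and of the last `N - m` positions such that `σᵃ σˢ` sends `γ` to `Ω`. -/
structure IsRearrangement {N m : ℕ} (γ : Fin N → ℕ) (Ω : Superpartition N m)
    (σa σs : Equiv.Perm (Fin N)) : Prop where
  fix_a : ∀ k : Fin N, m ≤ (k : ℕ) → σa k = k
  fix_s : ∀ k : Fin N, (k : ℕ) < m → σs k = k
  sends : ∀ k : Fin N, Ω.parts ((σa * σs) k) = γ k

/-- `Ω = R̄_{ij}^{(ℓ)} Λ`: the lowering operator with `i < j` does not annihilate `Λ`, and the
rearrangement of its value is the superpartition `Ω`, through the permutations `σᵃ`, `σˢ`. -/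
structure IsLowering {N m : ℕ} (Λ Ω : Superpartition N m) (i j : Fin N) (ℓ : ℕ)
    (σa σs : Equiv.Perm (Fin N)) : Prop where
  lt : i < j
  exists_eq : ∃ γ, lowering i j ℓ Λ = some γ ∧ IsRearrangement γ Ω σa σs

/-- The symmetry factor `n(a, b)` of a pair of the given type, in terms of the multiplicities of
the symmetric part of `Ω`. -/
def symmetryFactor (𝕜 : Type*) [Field 𝕜] {N m : ℕ} (Ω : Superpartition N m) (a b : ℕ) :
    PairType → 𝕜
  | .I => 1
  | .II => (Ω.mult b : 𝕜)
  | .III => if a = b then (1 / 2) * (Ω.mult a : 𝕜) * ((Ω.mult a : 𝕜) - 1)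
      else (Ω.mult a : 𝕜) * (Ω.mult b : 𝕜)

end SuperCMS

end

/-! The Hamiltonian is computed on `orbitSum`, the unnormalised superfunction of an arbitrary
sequence, so that nothing has to be sorted until the end. In the term of `σ` the pairs of variables
may be named `(σ i, σ j)`. On the Grassmann algebra `κ` exchanges two generators, and reindexing by
`σ ↦ σ * swap i j` moves this exchange to the exponents. Each pair of positions then multiplies the
fermionic word by a rational function whose poles cancel (`pair_expansion`): if the exponents differ
by `d`, what remains is `d` times the monomial plus `2 (d - l)` times the monomial with `l` units
moved from the larger to the smaller exponent, for `0 < l < d`. The diagonal part gives the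
eigenvalue.

Three facts convert this into the stated coefficients. An orbit sum is antisymmetric in the first
`m` entries and symmetric in the others, so it is `sgn σᵃ · f_Ω · m_Ω`, or zero when a fermionic
entry repeats. Moving `d - l` units instead of `l` exchanges the two resulting entries, so inside
one block these two terms combine: the weight becomes `d - 2l` for type I and `d` for type III (half
of it at the midpoint), while type II keeps `d - l`.

Finally, the contents of the two blocks of the lowered sequence determine the type, the two parts
and `l` (`eq_of_countOn_transfer_eq`). The pairs contributing to a given `m_Ω` therefore form a
product of two sets of positions with equal parts, and all carry the same sign. Their number times
`f_Ω / f_Λ`, with the midpoint half, is the symmetry factor (`weight_mul_norm`). -/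

noncomputable section

namespace SuperCMS

/-! ### Action of the Hamiltonian on single terms and on pairs of positions -/

section Words

variable {𝕜 : Type*} [Field 𝕜] {N m : ℕ}

/-- The monomial `∏ₖ z_{σ(k)} ^ γ k`. -/
def zMonomial (𝕜 : Type*) [Field 𝕜] (γ : Fin N → ℕ) (σ : Equiv.Perm (Fin N)) : RatFun 𝕜 N :=
  ∏ k, z (σ k) ^ γ k

/-- The fermionic monomial `θ_{σ(1)} ⋯ θ_{σ(m)}`. -/
def θMonomial (𝕜 : Type*) [Field 𝕜] (h : m ≤ N) (σ : Equiv.Perm (Fin N)) : Grassmann 𝕜 N :=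
  (List.ofFn fun k : Fin m => (θ (σ (Fin.castLE h k)) : Grassmann 𝕜 N)).prod

/-- The sum over `σ` of `θ_{σ(1)} ⋯ θ_{σ(m)} ∏ₖ z_{σ(k)} ^ γ k`, for an arbitrary sequence `γ`. -/
def orbitSum (𝕜 : Type*) [Field 𝕜] (h : m ≤ N) (γ : Fin N → ℕ) : SuperFun 𝕜 N :=
  ∑ σ, zMonomial 𝕜 γ σ ⊗ₜ[𝕜] θMonomial 𝕜 h σ

theorem sum_term (Λ : Superpartition N m) :
    ∑ σ, Λ.term 𝕜 σ = orbitSum 𝕜 Λ.m_le Λ.parts := rfl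

theorem zMonomial_comp (γ : Fin N → ℕ) (τ σ : Equiv.Perm (Fin N)) :
    zMonomial 𝕜 (γ ∘ τ) σ = zMonomial 𝕜 γ (σ * τ⁻¹) := by
  unfold zMonomial
  rw [← Equiv.prod_comp τ (fun k => (z ((σ * τ⁻¹) k) : RatFun 𝕜 N) ^ γ k)]
  simp

theorem orbitSum_comp (h : m ≤ N) (γ : Fin N → ℕ) (τ : Equiv.Perm (Fin N)) :
    orbitSum 𝕜 h (γ ∘ τ) = ∑ σ, zMonomial 𝕜 γ σ ⊗ₜ[𝕜] θMonomial 𝕜 h (σ * τ) := by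
  unfold orbitSum
  rw [← Equiv.sum_comp (Equiv.mulRight τ)]
  simp [zMonomial_comp]

theorem z_mul_partialZ_zMonomial (γ : Fin N → ℕ) (σ : Equiv.Perm (Fin N)) (i : Fin N) :
    z (σ i) * partialZ (σ i) (zMonomial 𝕜 γ σ) = (γ i : 𝕜) • zMonomial 𝕜 γ σ := by
  have h : zMonomial 𝕜 γ σ = algebraMap _ (RatFun 𝕜 N)
      (MvPolynomial.monomial (Finsupp.equivFunOnFinite.symm (γ ∘ σ.symm)) (1 : 𝕜)) := by
    rw [MvPolynomial.monomial_eq, Finsupp.prod_fintype _ _ (by simp),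
      ← Equiv.prod_comp σ]
    simp [zMonomial, z]
  rw [h, partialZ_algebraMap, z, ← map_mul, MvPolynomial.X_mul_pderiv_monomial]
  simp [Nat.cast_smul_eq_nsmul]

theorem euler_zMonomial (γ : Fin N → ℕ) (σ : Equiv.Perm (Fin N)) (i : Fin N)
    (w : Grassmann 𝕜 N) :
    euler (σ i) (zMonomial 𝕜 γ σ ⊗ₜ[𝕜] w) = (γ i : 𝕜) • (zMonomial 𝕜 γ σ ⊗ₜ[𝕜] w) := by
  simp [euler, z_mul_partialZ_zMonomial, TensorProduct.smul_tmul']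

theorem sum_euler_sq_zMonomial (γ : Fin N → ℕ) (σ : Equiv.Perm (Fin N)) (w : Grassmann 𝕜 N) :
    (∑ i, euler i ^ 2 : Module.End 𝕜 (SuperFun 𝕜 N)) (zMonomial 𝕜 γ σ ⊗ₜ[𝕜] w) =
      (∑ i, (γ i : 𝕜) ^ 2) • (zMonomial 𝕜 γ σ ⊗ₜ[𝕜] w) := by
  rw [← Equiv.sum_comp σ]
  simp only [LinearMap.sum_apply, Finset.sum_smul]
  refine Finset.sum_congr rfl fun i _ => ?_
  rw [pow_two, Module.End.mul_apply, euler_zMonomial, map_smul, euler_zMonomial, smul_smul, pow_two]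

/-- The exchange operator acts on the Grassmann algebra as the reflection that exchanges
two of the generators. -/
theorem exchange_ι_mul (i j : Fin N) (x : Fin N → 𝕜) (w : Grassmann 𝕜 N) :
    ExteriorAlgebra.ι 𝕜 x * w - (θ i - θ j) * (partialθ i - partialθ j : Module.End 𝕜 (Grassmann 𝕜 N))
        (ExteriorAlgebra.ι 𝕜 x * w) =
      ExteriorAlgebra.ι 𝕜 (x - (x i - x j) • (Pi.single i 1 - Pi.single j 1)) *
        (w - (θ i - θ j) * (partialθ i - partialθ j : Module.End 𝕜 (Grassmann 𝕜 N)) w) := by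
  have hθ : (θ i - θ j : Grassmann 𝕜 N) =
      ExteriorAlgebra.ι 𝕜 (Pi.single i 1 - Pi.single j 1) := by simp [θ]
  have hd (k : Fin N) : partialθ k (ExteriorAlgebra.ι 𝕜 x * w) =
      x k • w - ExteriorAlgebra.ι 𝕜 x * partialθ k w :=
    CliffordAlgebra.contractLeft_ι_mul (Q := 0) _ _ _
  rw [hθ, LinearMap.sub_apply, LinearMap.sub_apply, hd, hd]
  generalize (Pi.single i 1 - Pi.single j 1 : Fin N → 𝕜) = v
  -- With `c = x i - x j`, both sides expand to `x w - c v w - x v D`; the right side has the extra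
  -- term `c v v D`, which is zero.
  have hv : ExteriorAlgebra.ι 𝕜 v * ExteriorAlgebra.ι 𝕜 v = 0 := ExteriorAlgebra.ι_sq_zero v
  have hx : ExteriorAlgebra.ι 𝕜 v * ExteriorAlgebra.ι 𝕜 x =
      - (ExteriorAlgebra.ι 𝕜 x * ExteriorAlgebra.ι 𝕜 v) := by
    rw [eq_neg_iff_add_eq_zero, add_comm]; exact ExteriorAlgebra.ι_add_mul_swap x v
  have h1 : x i • w - ExteriorAlgebra.ι 𝕜 x * partialθ i w -
      (x j • w - ExteriorAlgebra.ι 𝕜 x * partialθ j w) =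
      (x i - x j) • w - ExteriorAlgebra.ι 𝕜 x * (partialθ i w - partialθ j w) := by
    rw [sub_smul, mul_sub]; abel
  rw [h1]
  generalize partialθ i w - partialθ j w = D
  rw [map_sub, map_smul, mul_sub, sub_mul, mul_sub, ← mul_assoc _ _ D, hx]
  simp only [mul_sub, smul_mul_assoc, ← mul_assoc, hv, mul_smul_comm, zero_mul, smul_zero, neg_mul]
  abel

/-- The operator fixes `1`, and `exchange_ι_mul` lets it pass one generator at a time. The
reflection along `e_i - e_j` permutes the basis vectors by the transposition of `i` and `j`. -/
theorem exchange_prod_θ (i j : Fin N) (l : List (Fin N)) :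
    (l.map (θ (𝕜 := 𝕜))).prod - (θ i - θ j) *
        (partialθ i - partialθ j : Module.End 𝕜 (Grassmann 𝕜 N)) (l.map (θ (𝕜 := 𝕜))).prod =
      ((l.map (Equiv.swap i j)).map (θ (𝕜 := 𝕜))).prod := by
  induction l with
  | nil =>
    have (k : Fin N) : partialθ k (1 : Grassmann 𝕜 N) = 0 :=
      CliffordAlgebra.contractLeft_one (Q := 0) _
    simp [this]
  | cons a l ih =>
    simp only [List.map_cons, List.prod_cons]
    rw [← ih]
    conv_lhs => rw [show (θ a : Grassmann 𝕜 N) = ExteriorAlgebra.ι 𝕜 (Pi.single a 1) from rfl]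
    rw [exchange_ι_mul]
    congr 2
    ext k
    by_cases hi : a = i
    · subst hi
      by_cases hj : a = j
      · subst hj; rw [Equiv.swap_self]; simp
      · simp [Pi.single_apply, Equiv.swap_apply_left, hj]
    · by_cases hj : a = j
      · subst hj; simp [Pi.single_apply, Equiv.swap_apply_right, Ne.symm hi]
      · simp [Equiv.swap_apply_of_ne_of_ne hi hj, Pi.single_apply, Ne.symm hi, Ne.symm hj]

theorem one_sub_κ_tmul_θMonomial (h : m ≤ N) (i j : Fin N) (f : RatFun 𝕜 N)
    (σ : Equiv.Perm (Fin N)) :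
    (1 - κ i j : Module.End 𝕜 (SuperFun 𝕜 N)) (f ⊗ₜ[𝕜] θMonomial 𝕜 h σ) =
      f ⊗ₜ[𝕜] (θMonomial 𝕜 h σ - θMonomial 𝕜 h (Equiv.swap i j * σ)) := by
  have := exchange_prod_θ (𝕜 := 𝕜) i j (List.ofFn fun k : Fin m => σ (Fin.castLE h k))
  rw [List.map_ofFn, List.map_ofFn, List.map_ofFn, sub_eq_iff_eq_add] at this
  have hκ : (1 - κ i j : Module.End 𝕜 (SuperFun 𝕜 N)) = LinearMap.lTensor (RatFun 𝕜 N)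
      (LinearMap.mulLeft 𝕜 (θ i - θ j : Grassmann 𝕜 N) ∘ₗ (partialθ i - partialθ j)) :=
    LinearMap.ext fun x => sub_sub_cancel (G := SuperFun 𝕜 N) _ _
  rw [hκ, LinearMap.lTensor_tmul, LinearMap.comp_apply, LinearMap.mulLeft_apply]
  refine congrArg (f ⊗ₜ[𝕜] ·) ?_
  rw [eq_sub_iff_add_eq, add_comm]
  exact this.symm

/-- Together with `pairF_comm`, this makes the interaction a sum over unordered pairs, which may be
relabelled by any `σ`. -/
theorem pairB_comm (i j : Fin N) : (pairB i j : Module.End 𝕜 (SuperFun 𝕜 N)) = pairB j i := by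
  have h : (z i + z j) / (z i - z j) = -((z j + z i) / (z j - z i : RatFun 𝕜 N)) := by
    rw [← div_neg, neg_sub, add_comm]
  have h2 (f : RatFun 𝕜 N) : mulZ (-f) = -mulZ f := by
    unfold mulZ
    rw [← LinearMap.rTensor_neg]
    congr 1
    ext; simp
  rw [pairB, pairB, h, h2]
  refine LinearMap.ext fun x => ?_
  simp only [Module.End.mul_apply, LinearMap.neg_apply, LinearMap.sub_apply]
  rw [← map_neg, neg_sub]

theorem pairF_comm (i j : Fin N) : (pairF i j : Module.End 𝕜 (SuperFun 𝕜 N)) = pairF j i := by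
  have h : (z i - z j : RatFun 𝕜 N) ^ 2 = (z j - z i) ^ 2 := by ring
  have h2 : (κ i j : Module.End 𝕜 (SuperFun 𝕜 N)) = κ j i := by
    unfold κ
    congr 2
    refine LinearMap.ext fun w => ?_
    simp only [LinearMap.comp_apply, LinearMap.mulLeft_apply, LinearMap.sub_apply]
    rw [← neg_sub (θ j), ← neg_sub (partialθ j w), neg_mul_neg]
  rw [pairF, pairF, h, h2, mul_comm (z i)]

/-- Contribution of one pair to the action of the Hamiltonian on an orbit sum, as a rational
function multiplying each fermionic monomial. -/
theorem sum_pair_apply (h : m ≤ N) (γ : Fin N → ℕ) (i j : Fin N) :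
    ∑ σ : Equiv.Perm (Fin N), (pairB (σ i) (σ j) - (2 : 𝕜) • pairF (σ i) (σ j) :
          Module.End 𝕜 (SuperFun 𝕜 N))
        (zMonomial 𝕜 γ σ ⊗ₜ[𝕜] θMonomial 𝕜 h σ) =
      ∑ σ : Equiv.Perm (Fin N),
        ((z (σ i) + z (σ j)) / (z (σ i) - z (σ j)) *
            (((γ i : RatFun 𝕜 N) - (γ j : RatFun 𝕜 N)) * zMonomial 𝕜 γ σ) -
          2 * (z (σ i) * z (σ j) / (z (σ i) - z (σ j)) ^ 2 *
            (zMonomial 𝕜 γ σ - zMonomial 𝕜 (γ ∘ Equiv.swap i j) σ))) ⊗ₜ[𝕜]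
          θMonomial 𝕜 h σ := by
  set φ : Equiv.Perm (Fin N) → RatFun 𝕜 N := fun σ =>
    z (σ i) * z (σ j) / (z (σ i) - z (σ j)) ^ 2 with hφ
  have hB (σ : Equiv.Perm (Fin N)) : pairB (σ i) (σ j)
      (zMonomial 𝕜 γ σ ⊗ₜ[𝕜] θMonomial 𝕜 h σ) =
      ((z (σ i) + z (σ j)) / (z (σ i) - z (σ j)) *
            (((γ i : RatFun 𝕜 N) - (γ j : RatFun 𝕜 N)) * zMonomial 𝕜 γ σ)) ⊗ₜ[𝕜] θMonomial 𝕜 h σ := by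
    rw [pairB, Module.End.mul_apply, LinearMap.sub_apply, euler_zMonomial, euler_zMonomial,
      show ∀ x : SuperFun 𝕜 N, (γ i : 𝕜) • x - (γ j : 𝕜) • x = ((γ i : 𝕜) - (γ j : 𝕜)) • x from
        fun x => (sub_smul _ _ x).symm, TensorProduct.smul_tmul', mulZ, LinearMap.rTensor_tmul, LinearMap.mulLeft_apply,
      Algebra.smul_def, map_sub, map_natCast, map_natCast]
  have hF (σ : Equiv.Perm (Fin N)) : pairF (σ i) (σ j)
      (zMonomial 𝕜 γ σ ⊗ₜ[𝕜] θMonomial 𝕜 h σ) =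
      (φ σ * zMonomial 𝕜 γ σ) ⊗ₜ[𝕜] θMonomial 𝕜 h σ -
        (φ σ * zMonomial 𝕜 γ σ) ⊗ₜ[𝕜] θMonomial 𝕜 h (σ * Equiv.swap i j) := by
    rw [pairF, Module.End.mul_apply, one_sub_κ_tmul_θMonomial, mulZ, LinearMap.rTensor_tmul,
      LinearMap.mulLeft_apply, TensorProduct.tmul_sub, Equiv.mul_swap_eq_swap_mul]
  -- Since `φ` is invariant under `σ ↦ σ * swap i j`, reindexing turns the exchanged fermionic word
  -- into exchanged exponents, and the numerator over the double pole becomes a difference that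
  -- vanishes at `z (σ i) = z (σ j)`.
  have hS : ∑ σ : Equiv.Perm (Fin N), (φ σ * zMonomial 𝕜 γ σ) ⊗ₜ[𝕜]
        θMonomial 𝕜 h (σ * Equiv.swap i j) =
      ∑ σ : Equiv.Perm (Fin N), (φ σ * zMonomial 𝕜 (γ ∘ Equiv.swap i j) σ) ⊗ₜ[𝕜]
        θMonomial 𝕜 h σ := by
    rw [← Equiv.sum_comp (Equiv.mulRight (Equiv.swap i j))
      (fun σ => (φ σ * zMonomial 𝕜 (γ ∘ Equiv.swap i j) σ) ⊗ₜ[𝕜] θMonomial 𝕜 h σ)]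
    refine Finset.sum_congr rfl fun σ _ => ?_
    congr 2
    · simp only [hφ, Equiv.coe_mulRight, Equiv.Perm.mul_apply, Equiv.swap_apply_left,
        Equiv.swap_apply_right]
      rw [mul_comm (z (σ j)), ← neg_sub (z (σ i)), neg_sq]
    · rw [zMonomial_comp]
      simp [mul_assoc]
  simp only [LinearMap.sub_apply, LinearMap.smul_apply, hB, hF, Finset.sum_sub_distrib,
    ← Finset.smul_sum, hS, TensorProduct.sub_tmul]
  congr 1
  rw [← Finset.sum_sub_distrib, Finset.smul_sum]
  refine Finset.sum_congr rfl fun σ _ => ?_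
  rw [← TensorProduct.sub_tmul, ← mul_sub, TensorProduct.smul_tmul', Algebra.smul_def]
  rw [map_ofNat]

end Words

/-! ### Cancellation of poles and the Hamiltonian on orbit sums -/

section PairExpansion

/-- Induction on `d`: the `l = 0` term splits off, and the rest is `q` times the previous sum. -/
theorem sub_sq_mul_sum_pow {K : Type*} [CommRing K] (p q : K) (d : ℕ) :
    (p - q) ^ 2 * ∑ l ∈ Finset.range d, ((d : K) - l) * (p ^ (d - l) * q ^ l) =
      d * (p - q) * p ^ (d + 1) - p * q * (p ^ d - q ^ d) := by
  induction d with
  | zero => simp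
  | succ d ih =>
    have h : ∑ l ∈ Finset.range (d + 1), (((d + 1 : ℕ) : K) - l) * (p ^ (d + 1 - l) * q ^ l) =
        q * ∑ l ∈ Finset.range d, ((d : K) - l) * (p ^ (d - l) * q ^ l) +
          (d + 1) * p ^ (d + 1) := by
      rw [Finset.sum_range_succ', Finset.mul_sum]
      congr 1
      · refine Finset.sum_congr rfl fun l _ => ?_
        rw [Nat.add_sub_add_right]
        push_cast
        ring
      · simp
    rw [h, mul_add, mul_left_comm, ih]
    push_cast
    ring

/-- After removal of the common factor `(p q) ^ b`, this is `sub_sq_mul_sum_pow` divided by `(p - q)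
^ 2`: the double pole left by the exchange term is compensated by the differential term. -/
theorem pair_expansion {K : Type*} [Field K] {p q : K} (hpq : p ≠ q) {a b : ℕ} (hab : b ≤ a) :
    (p + q) / (p - q) * (((a : K) - b) * (p ^ a * q ^ b)) -
        2 * (p * q / (p - q) ^ 2 * (p ^ a * q ^ b - p ^ b * q ^ a)) =
      ((a - b : ℕ) : K) * (p ^ a * q ^ b) + 2 * ∑ l ∈ Finset.Ioo 0 (a - b),
        (((a - b : ℕ) : K) - l) * (p ^ (a - l) * q ^ (b + l)) := by
  obtain ⟨d, rfl⟩ := Nat.exists_eq_add_of_le hab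
  have h0 : p - q ≠ 0 := sub_ne_zero.2 hpq
  -- The full sum starts at `l = 0`; the subtracted `d * p ^ d` is that first term, which belongs to
  -- the diagonal part.
  have hS : ∑ l ∈ Finset.Ioo 0 d, ((d : K) - l) * (p ^ (b + d - l) * q ^ (b + l)) =
      (p * q) ^ b * (∑ l ∈ Finset.range d, ((d : K) - l) * (p ^ (d - l) * q ^ l) - d * p ^ d) := by
    rcases Nat.eq_zero_or_pos d with rfl | hd
    · simp
    · have hr : Finset.range d = insert 0 (Finset.Ioo 0 d) := by
        ext l; simp; omega
      rw [hr, Finset.sum_insert (by simp)]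
      simp only [Nat.cast_zero, sub_zero, Nat.sub_zero, pow_zero, mul_one, add_sub_cancel_left,
        Finset.mul_sum]
      refine Finset.sum_congr rfl fun l hl => ?_
      rw [Nat.add_sub_assoc (Finset.mem_Ioo.1 hl).2.le, pow_add, pow_add, mul_pow]
      ring
  rw [Nat.add_sub_cancel_left, hS]
  have hG := sub_sq_mul_sum_pow p q d
  generalize ∑ l ∈ Finset.range d, ((d : K) - l) * (p ^ (d - l) * q ^ l) = G at hG ⊢
  have hG' : G = (d * (p - q) * p ^ (d + 1) - p * q * (p ^ d - q ^ d)) / (p - q) ^ 2 := by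
    rw [← hG]; field_simp
  rw [hG']
  push_cast
  field_simp
  ring

variable {𝕜 : Type*} [Field 𝕜] {N m : ℕ}

theorem z_injective : Function.Injective (z : Fin N → RatFun 𝕜 N) := fun _ _ h =>
  MvPolynomial.X_injective (IsFractionRing.injective _ (RatFun 𝕜 N) h)

/-- The sequence obtained from `γ` by moving `l` units from the larger to the smaller of the
entries at `i` and `j`. -/
def transfer (γ : Fin N → ℕ) (i j : Fin N) (l : ℕ) : Fin N → ℕ :=
  if γ j < γ i then Function.update (Function.update γ i (γ i - l)) j (γ j + l)
  else Function.update (Function.update γ i (γ i + l)) j (γ j - l)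

theorem transfer_of_ne (γ : Fin N → ℕ) {i j k : Fin N} (l : ℕ) (hi : k ≠ i) (hj : k ≠ j) :
    transfer γ i j l k = γ k := by
  unfold transfer
  split_ifs <;> simp [hi, hj]

theorem transfer_left (γ : Fin N → ℕ) {i j : Fin N} (l : ℕ) (hij : i ≠ j) :
    transfer γ i j l i = if γ j < γ i then γ i - l else γ i + l := by
  unfold transfer
  split_ifs <;> simp [hij]

theorem transfer_right (γ : Fin N → ℕ) (i j : Fin N) (l : ℕ) :
    transfer γ i j l j = if γ j < γ i then γ j + l else γ j - l := by
  unfold transfer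
  split_ifs <;> simp

/-- The difference between the entries of `γ` at `i` and `j`. -/
def gap (γ : Fin N → ℕ) (i j : Fin N) : ℕ := (γ i - γ j) + (γ j - γ i)

theorem zMonomial_eq_mul (γ : Fin N → ℕ) {i j : Fin N} (hij : i ≠ j) (σ : Equiv.Perm (Fin N)) :
    zMonomial 𝕜 γ σ = z (σ i) ^ γ i * z (σ j) ^ γ j *
      ∏ k ∈ (Finset.univ.erase i).erase j, z (σ k) ^ γ k := by
  rw [zMonomial, ← Finset.mul_prod_erase _ _ (Finset.mem_univ i), mul_assoc,
    Finset.mul_prod_erase _ (fun k => (z (σ k) : RatFun 𝕜 N) ^ γ k)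
      (Finset.mem_erase.2 ⟨hij.symm, Finset.mem_univ j⟩)]

theorem zMonomial_pair (γ γ' : Fin N → ℕ) {i j : Fin N} (hij : i ≠ j) (σ : Equiv.Perm (Fin N))
    (h : ∀ k, k ≠ i → k ≠ j → γ' k = γ k) :
    zMonomial 𝕜 γ' σ = z (σ i) ^ γ' i * z (σ j) ^ γ' j *
      ∏ k ∈ (Finset.univ.erase i).erase j, z (σ k) ^ γ k := by
  rw [zMonomial_eq_mul γ' hij]
  congr 1
  refine Finset.prod_congr rfl fun k hk => ?_
  simp only [Finset.mem_erase] at hk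
  rw [h k hk.2.1 hk.1]

/-- The variables at other positions form a common factor `r`. Both coefficients are invariant under
simultaneous exchange of the variables and the exponents, so the case `γ i ≤ γ j` is
`pair_expansion` with `p` and `q` interchanged. -/
theorem pair_zMonomial (γ : Fin N → ℕ) {i j : Fin N} (hij : i ≠ j) (σ : Equiv.Perm (Fin N)) :
    (z (σ i) + z (σ j)) / (z (σ i) - z (σ j)) *
        (((γ i : RatFun 𝕜 N) - (γ j : RatFun 𝕜 N)) * zMonomial 𝕜 γ σ) -
      2 * (z (σ i) * z (σ j) / (z (σ i) - z (σ j)) ^ 2 *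
        (zMonomial 𝕜 γ σ - zMonomial 𝕜 (γ ∘ Equiv.swap i j) σ)) =
    (gap γ i j : 𝕜) • zMonomial 𝕜 γ σ + (2 : 𝕜) • ∑ l ∈ Finset.Ioo 0 (gap γ i j),
      ((gap γ i j : 𝕜) - l) • zMonomial 𝕜 (transfer γ i j l) σ := by
  have hz : (z (σ i) : RatFun 𝕜 N) ≠ z (σ j) := fun h => hij (σ.injective (z_injective h))
  rw [zMonomial_pair γ (γ ∘ Equiv.swap i j) hij σ
    (fun k hi hj => by simp [Equiv.swap_apply_of_ne_of_ne hi hj])]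
  simp only [fun l => zMonomial_pair (𝕜 := 𝕜) γ (transfer γ i j l) hij σ
    (fun k hi hj => transfer_of_ne γ l hi hj), zMonomial_eq_mul γ hij]
  generalize ∏ k ∈ (Finset.univ.erase i).erase j, (z (σ k) : RatFun 𝕜 N) ^ γ k = r
  simp only [Function.comp_apply, Equiv.swap_apply_left, Equiv.swap_apply_right,
    transfer_left γ _ hij, transfer_right, Algebra.smul_def, map_sub, map_natCast, map_ofNat]
  generalize (z (σ i) : RatFun 𝕜 N) = p at hz ⊢
  generalize (z (σ j) : RatFun 𝕜 N) = q at hz ⊢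
  rcases lt_or_ge (γ j) (γ i) with hlt | hge
  · have hg : gap γ i j = γ i - γ j := by unfold gap; omega
    have := congrArg (· * r) (pair_expansion hz hlt.le)
    simp only [hlt, if_true, hg]
    simp only [← mul_assoc, ← Finset.sum_mul] at this ⊢
    rw [add_mul] at this
    rw [← this]
    ring
  · have hg : gap γ i j = γ j - γ i := by unfold gap; omega
    have := congrArg (· * r) (pair_expansion hz.symm hge)
    simp only [not_lt.2 hge, if_false, hg]
    simp only [mul_comm (p ^ _) (q ^ _)]
    simp only [← mul_assoc, ← Finset.sum_mul] at this ⊢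
    rw [add_mul] at this
    rw [← this]
    have h1 : p - q ≠ 0 := sub_ne_zero.2 hz
    have h2 : q - p ≠ 0 := sub_ne_zero.2 hz.symm
    have h3 : (p + q) / (p - q) = - ((q + p) / (q - p)) := by
      rw [← div_neg, neg_sub, add_comm]
    have h4 : (p - q) ^ 2 = (q - p) ^ 2 := by ring
    rw [h3, h4]
    ring

theorem sum_pair_orbit (h : m ≤ N) (γ : Fin N → ℕ) {i j : Fin N} (hij : i ≠ j) :
    ∑ σ : Equiv.Perm (Fin N), (pairB (σ i) (σ j) - (2 : 𝕜) • pairF (σ i) (σ j) :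
          Module.End 𝕜 (SuperFun 𝕜 N)) (zMonomial 𝕜 γ σ ⊗ₜ[𝕜] θMonomial 𝕜 h σ) =
      (gap γ i j : 𝕜) • orbitSum 𝕜 h γ + (2 : 𝕜) • ∑ l ∈ Finset.Ioo 0 (gap γ i j),
        ((gap γ i j : 𝕜) - l) • orbitSum 𝕜 h (transfer γ i j l) := by
  rw [sum_pair_apply]
  simp only [pair_zMonomial γ hij, TensorProduct.add_tmul, Finset.sum_add_distrib, orbitSum,
    ← TensorProduct.smul_tmul', TensorProduct.sum_tmul, Finset.smul_sum]
  congr 1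
  exact Finset.sum_comm

theorem two_smul_sum_Ioi {A : Type*} [AddCommMonoid A] (f : Fin N → Fin N → A)
    (hf : ∀ i j, f i j = f j i) :
    2 • ∑ i, ∑ j ∈ Finset.Ioi i, f i j = ∑ i, ∑ j ∈ Finset.univ.erase i, f i j := by
  have h (i : Fin N) : Finset.univ.erase i = Finset.Iio i ∪ Finset.Ioi i := by
    ext k; simp [lt_or_lt_iff_ne]
  have hd (i : Fin N) : Disjoint (Finset.Iio i) (Finset.Ioi i) := by
    rw [Finset.disjoint_left]; intro k hk hk'
    simp only [Finset.mem_Iio, Finset.mem_Ioi] at hk hk'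
    exact lt_asymm hk hk'
  simp only [h, Finset.sum_union (hd _), Finset.sum_add_distrib, two_nsmul]
  congr 1
  rw [Finset.sum_comm' (t' := Finset.univ) (s' := fun j => Finset.Iio j) (by simp)]
  simp only [fun i j => hf j i]

/-- A permutation preserves the condition `i ≠ j` but not `i < j`, so the comparison is made for the
doubled sum, and the factor `2` is cancelled afterwards. -/
theorem sum_Ioi_perm [CharZero 𝕜] {A : Type*} [AddCommGroup A] [Module 𝕜 A]
    (f : Fin N → Fin N → A) (hf : ∀ i j, f i j = f j i) (σ : Equiv.Perm (Fin N)) :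
    ∑ i, ∑ j ∈ Finset.Ioi i, f (σ i) (σ j) = ∑ i, ∑ j ∈ Finset.Ioi i, f i j := by
  have h := two_smul_sum_Ioi (fun i j => f (σ i) (σ j)) (fun i j => hf _ _)
  have h' := two_smul_sum_Ioi f hf
  have : ∑ i, ∑ j ∈ Finset.univ.erase i, f (σ i) (σ j) =
      ∑ i, ∑ j ∈ Finset.univ.erase i, f i j := by
    rw [← Equiv.sum_comp σ (fun i => ∑ j ∈ Finset.univ.erase i, f i j)]
    refine Finset.sum_congr rfl fun i _ => ?_
    exact Finset.sum_equiv σ (by simp) fun _ _ => rfl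
  rw [this, ← h', ← Nat.cast_smul_eq_nsmul 𝕜, ← Nat.cast_smul_eq_nsmul 𝕜] at h
  exact smul_right_injective A (r := ((2 : ℕ) : 𝕜)) (by norm_num) h

theorem combine_pairs {A : Type*} [AddCommGroup A] [Module 𝕜 A] (β : 𝕜) (e : A)
    (b f : Fin N → Fin N → A) :
    e + β • (∑ i, ∑ j ∈ Finset.Ioi i, b i j) - (2 * β) • (∑ i, ∑ j ∈ Finset.Ioi i, f i j) =
      e + β • ∑ i, ∑ j ∈ Finset.Ioi i, (b i j - (2 : 𝕜) • f i j) := by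
  simp only [Finset.sum_sub_distrib, ← Finset.smul_sum]
  rw [smul_sub, smul_smul, mul_comm, add_sub_assoc]

theorem hamiltonian_eq (β : 𝕜) :
    (hamiltonian β : Module.End 𝕜 (SuperFun 𝕜 N)) = (∑ i, euler i ^ 2) +
      β • ∑ i, ∑ j ∈ Finset.Ioi i, (pairB i j - (2 : 𝕜) • pairF i j) := by
  refine LinearMap.ext fun x => ?_
  simp only [hamiltonian, LinearMap.sub_apply, LinearMap.add_apply, LinearMap.smul_apply,
    LinearMap.sum_apply]
  exact combine_pairs (A := SuperFun 𝕜 N) β _ (fun i j => pairB i j x) (fun i j => pairF i j x)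

/-- In the term of `σ` the sum over pairs of variables is rewritten as a sum over pairs of
positions; the sum over `σ` can then be taken for each fixed pair. -/
theorem sum_pairs_orbitSum [CharZero 𝕜] (h : m ≤ N) (γ : Fin N → ℕ) :
    (∑ i, ∑ j ∈ Finset.Ioi i, (pairB i j - (2 : 𝕜) • pairF i j) : Module.End 𝕜 (SuperFun 𝕜 N))
        (orbitSum 𝕜 h γ) =
      ∑ i, ∑ j ∈ Finset.Ioi i, ((gap γ i j : 𝕜) • orbitSum 𝕜 h γ +
        (2 : 𝕜) • ∑ l ∈ Finset.Ioo 0 (gap γ i j),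
          ((gap γ i j : 𝕜) - l) • orbitSum 𝕜 h (transfer γ i j l)) := by
  have hDs (i j : Fin N) : (pairB i j - (2 : 𝕜) • pairF i j : Module.End 𝕜 (SuperFun 𝕜 N)) =
      pairB j i - (2 : 𝕜) • pairF j i := by rw [pairB_comm, pairF_comm]
  calc _ = ∑ σ : Equiv.Perm (Fin N), (∑ i, ∑ j ∈ Finset.Ioi i,
          (pairB (σ i) (σ j) - (2 : 𝕜) • pairF (σ i) (σ j)) : Module.End 𝕜 (SuperFun 𝕜 N))
          (zMonomial 𝕜 γ σ ⊗ₜ[𝕜] θMonomial 𝕜 h σ) := by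
        rw [orbitSum, map_sum]
        exact Finset.sum_congr rfl fun σ _ => by
          rw [sum_Ioi_perm (𝕜 := 𝕜) (fun i j => pairB i j - (2 : 𝕜) • pairF i j) hDs σ]
    _ = ∑ i, ∑ j ∈ Finset.Ioi i, ∑ σ : Equiv.Perm (Fin N),
          (pairB (σ i) (σ j) - (2 : 𝕜) • pairF (σ i) (σ j) : Module.End 𝕜 (SuperFun 𝕜 N))
          (zMonomial 𝕜 γ σ ⊗ₜ[𝕜] θMonomial 𝕜 h σ) := by
        simp only [LinearMap.sum_apply]
        rw [Finset.sum_comm]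
        exact Finset.sum_congr rfl fun i _ => Finset.sum_comm
    _ = _ := Finset.sum_congr rfl fun i _ => Finset.sum_congr rfl fun j hj =>
        sum_pair_orbit h γ (Finset.mem_Ioi.1 hj).ne

theorem hamiltonian_orbitSum [CharZero 𝕜] (β : 𝕜) (h : m ≤ N) (γ : Fin N → ℕ) :
    hamiltonian β (orbitSum 𝕜 h γ) =
      (∑ i, (γ i : 𝕜) ^ 2 + β * ∑ i, ∑ j ∈ Finset.Ioi i, (gap γ i j : 𝕜)) • orbitSum 𝕜 h γ +
        (2 * β) • ∑ i, ∑ j ∈ Finset.Ioi i, ∑ l ∈ Finset.Ioo 0 (gap γ i j),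
          ((gap γ i j : 𝕜) - l) • orbitSum 𝕜 h (transfer γ i j l) := by
  have hE : (∑ i, euler i ^ 2 : Module.End 𝕜 (SuperFun 𝕜 N)) (orbitSum 𝕜 h γ) =
      (∑ i, (γ i : 𝕜) ^ 2) • orbitSum 𝕜 h γ := by
    rw [orbitSum, map_sum, Finset.smul_sum]
    exact Finset.sum_congr rfl fun σ _ => sum_euler_sq_zMonomial γ σ _
  rw [hamiltonian_eq, LinearMap.add_apply, LinearMap.smul_apply, hE, sum_pairs_orbitSum]
  generalize orbitSum 𝕜 h γ = x
  simp only [Finset.sum_add_distrib, ← Finset.smul_sum, ← Finset.sum_smul]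
  rw [smul_add, smul_smul, smul_smul, add_smul, add_assoc, mul_comm 2 β]

end PairExpansion

/-! ### Orbit sums as signed multiples of monomial superfunctions -/

section Rearrangement

variable {𝕜 : Type*} [Field 𝕜] {N m : ℕ}

theorem lt_iff_of_fix_ge {τ : Equiv.Perm (Fin N)} (h : ∀ k : Fin N, m ≤ (k : ℕ) → τ k = k)
    (k : Fin N) : (τ k : ℕ) < m ↔ (k : ℕ) < m := by
  constructor
  · intro hk
    by_contra hk'
    rw [h k (not_lt.1 hk')] at hk
    exact hk' hk
  · intro hk
    by_contra hk'
    have := τ.injective (h _ (not_lt.1 hk'))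
    rw [this] at hk'
    exact hk' hk

theorem lt_iff_of_fix_lt {τ : Equiv.Perm (Fin N)} (h : ∀ k : Fin N, (k : ℕ) < m → τ k = k)
    (k : Fin N) : (τ k : ℕ) < m ↔ (k : ℕ) < m := by
  constructor
  · intro hk
    have := τ.injective (h _ hk)
    rwa [this] at hk
  · intro hk
    rwa [h k hk]

theorem θMonomial_mul_of_fix_ge (h : m ≤ N) (σ : Equiv.Perm (Fin N)) {τ : Equiv.Perm (Fin N)}
    (hτ : ∀ k : Fin N, m ≤ (k : ℕ) → τ k = k) :
    θMonomial 𝕜 h (σ * τ) = ((Equiv.Perm.sign τ : ℤ) : 𝕜) • θMonomial 𝕜 h σ := by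
  have hιM (ρ : Equiv.Perm (Fin N)) : θMonomial 𝕜 h ρ =
      ExteriorAlgebra.ιMulti 𝕜 m (fun k : Fin m => Pi.single (ρ (Fin.castLE h k)) (1 : 𝕜)) := by
    rw [ExteriorAlgebra.ιMulti_apply]; rfl
  let e : Fin m ≃ {k : Fin N // (k : ℕ) < m} :=
    { toFun := fun k => ⟨Fin.castLE h k, k.2⟩
      invFun := fun k => ⟨k.1, k.2⟩
      left_inv := fun _ => rfl
      right_inv := fun _ => rfl }
  -- The word is a value of the alternating map `ιMulti`, so `τ` acts on it through its restriction
  -- to the first `m` positions; the sign is unchanged because `τ` moves nothing else.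
  let τ' : Equiv.Perm (Fin m) :=
    e.symm.permCongr (τ.subtypePerm fun k => lt_iff_of_fix_ge hτ k)
  have hs : Equiv.Perm.sign τ' = Equiv.Perm.sign τ := by
    rw [Equiv.Perm.sign_permCongr, Equiv.Perm.sign_subtypePerm]
    intro k hk
    by_contra hk'
    exact hk (hτ k (not_lt.1 hk'))
  have hτ' (k : Fin m) : Fin.castLE h (τ' k) = τ (Fin.castLE h k) := rfl
  have := (ExteriorAlgebra.ιMulti 𝕜 m).map_perm
    (fun k : Fin m => (Pi.single (σ (Fin.castLE h k)) (1 : 𝕜) : Fin N → 𝕜)) τ'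
  rw [hs] at this
  rw [hιM, hιM, Int.cast_smul_eq_zsmul]
  exact this

theorem θMonomial_mul_of_fix_lt (h : m ≤ N) (σ : Equiv.Perm (Fin N)) {τ : Equiv.Perm (Fin N)}
    (hτ : ∀ k : Fin N, (k : ℕ) < m → τ k = k) : θMonomial 𝕜 h (σ * τ) = θMonomial 𝕜 h σ := by
  unfold θMonomial
  congr 2
  funext k
  rw [Equiv.Perm.mul_apply, hτ _ (by simp)]

theorem orbitSum_comp_mul (h : m ≤ N) (γ : Fin N → ℕ) {σa σs : Equiv.Perm (Fin N)}
    (ha : ∀ k : Fin N, m ≤ (k : ℕ) → σa k = k) (hs : ∀ k : Fin N, (k : ℕ) < m → σs k = k) :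
    orbitSum 𝕜 h (γ ∘ (σa * σs : Equiv.Perm (Fin N))) =
      ((Equiv.Perm.sign σa : ℤ) : 𝕜) • orbitSum 𝕜 h γ := by
  rw [orbitSum_comp, orbitSum, Finset.smul_sum]
  refine Finset.sum_congr rfl fun σ _ => ?_
  rw [← mul_assoc, θMonomial_mul_of_fix_lt h _ hs, θMonomial_mul_of_fix_ge h _ ha,
    TensorProduct.tmul_smul]

theorem orbitSum_comp_swap_lt (h : m ≤ N) (γ : Fin N → ℕ) {i j : Fin N} (hij : i ≠ j)
    (hi : (i : ℕ) < m) (hj : (j : ℕ) < m) :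
    orbitSum 𝕜 h (γ ∘ Equiv.swap i j) = -orbitSum 𝕜 h γ := by
  have := orbitSum_comp_mul (𝕜 := 𝕜) h γ (σa := Equiv.swap i j) (σs := 1)
    (fun k hk => Equiv.swap_apply_of_ne_of_ne (by rintro rfl; omega) (by rintro rfl; omega))
    (fun _ _ => rfl)
  rw [mul_one, Equiv.Perm.sign_swap hij, Units.val_neg, Units.val_one, Int.cast_neg,
    Int.cast_one] at this
  exact this.trans (neg_one_smul 𝕜 (orbitSum 𝕜 h γ))

theorem orbitSum_comp_swap_ge (h : m ≤ N) (γ : Fin N → ℕ) {i j : Fin N}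
    (hi : m ≤ (i : ℕ)) (hj : m ≤ (j : ℕ)) :
    orbitSum 𝕜 h (γ ∘ Equiv.swap i j) = orbitSum 𝕜 h γ := by
  have := orbitSum_comp_mul (𝕜 := 𝕜) h γ (σa := 1) (σs := Equiv.swap i j) (fun _ _ => rfl)
    (fun k hk => Equiv.swap_apply_of_ne_of_ne (by rintro rfl; omega) (by rintro rfl; omega))
  rw [one_mul] at this
  rw [this]
  simp

/-- Exchanging the two equal entries fixes the sequence and negates the orbit sum. -/
theorem orbitSum_eq_zero [CharZero 𝕜] (h : m ≤ N) (γ : Fin N → ℕ) {i j : Fin N} (hij : i ≠ j)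
    (hi : (i : ℕ) < m) (hj : (j : ℕ) < m) (hγ : γ i = γ j) : orbitSum 𝕜 h γ = 0 := by
  have hc : γ ∘ Equiv.swap i j = γ := by
    funext k
    rcases eq_or_ne k i with rfl | hki
    · simp [hγ]
    rcases eq_or_ne k j with rfl | hkj
    · simp [hγ]
    simp [Equiv.swap_apply_of_ne_of_ne hki hkj]
  have := orbitSum_comp_swap_lt (𝕜 := 𝕜) h γ hij hi hj
  rw [hc, eq_neg_iff_add_eq_zero, ← two_smul 𝕜] at this
  exact (smul_eq_zero.1 this).resolve_left two_ne_zero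

theorem norm_smul_monomial [CharZero 𝕜] (Λ : Superpartition N m) :
    (Λ.norm : 𝕜) • Λ.monomial 𝕜 = orbitSum 𝕜 Λ.m_le Λ.parts := by
  rw [Superpartition.monomial, sum_term, smul_smul, mul_inv_cancel₀, one_smul]
  rw [Nat.cast_ne_zero, Superpartition.norm, Finset.prod_ne_zero_iff]
  exact fun a _ => Nat.factorial_ne_zero _

theorem IsRearrangement.comp_eq {γ : Fin N → ℕ} {Ω : Superpartition N m}
    {σa σs : Equiv.Perm (Fin N)} (h : IsRearrangement γ Ω σa σs) :
    Ω.parts ∘ (σa * σs : Equiv.Perm (Fin N)) = γ := funext h.sends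

theorem IsRearrangement.lt_iff {γ : Fin N → ℕ} {Ω : Superpartition N m}
    {σa σs : Equiv.Perm (Fin N)} (h : IsRearrangement γ Ω σa σs) (k : Fin N) :
    ((σa * σs : Equiv.Perm (Fin N)) k : ℕ) < m ↔ (k : ℕ) < m := by
  rw [Equiv.Perm.mul_apply, lt_iff_of_fix_ge h.fix_a, lt_iff_of_fix_lt h.fix_s]

theorem IsRearrangement.orbitSum_eq [CharZero 𝕜] {γ : Fin N → ℕ} {Ω : Superpartition N m}
    {σa σs : Equiv.Perm (Fin N)} (h : IsRearrangement γ Ω σa σs) :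
    orbitSum 𝕜 Ω.m_le γ =
      (((Equiv.Perm.sign σa : ℤ) : 𝕜) * Ω.norm) • Ω.monomial 𝕜 := by
  rw [mul_smul, norm_smul_monomial, ← orbitSum_comp_mul _ _ h.fix_a h.fix_s, h.comp_eq]

/-- The fermionic positions come first, and within each block larger parts come first. -/
def sortKey (m : ℕ) (γ : Fin N → ℕ) (k : Fin N) : ℕ ×ₗ ℕᵒᵈ :=
  toLex (if (k : ℕ) < m then 0 else 1, OrderDual.toDual (γ k))

theorem sortKey_le_iff (γ γ' : Fin N → ℕ) (k l : Fin N) :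
    sortKey m γ k ≤ sortKey m γ' l ↔
      ((k : ℕ) < m ∧ m ≤ (l : ℕ)) ∨ (((k : ℕ) < m ↔ (l : ℕ) < m) ∧ γ' l ≤ γ k) := by
  unfold sortKey
  rw [Prod.Lex.toLex_le_toLex]
  simp only [OrderDual.toDual_le_toDual]
  by_cases hk : (k : ℕ) < m <;> by_cases hl : (l : ℕ) < m <;> simp [hk, hl]
  omega

/-- Superpartitions are sorted for this key, so uniqueness of the rearrangement reduces to
uniqueness of sorted tuples. -/
theorem Superpartition.monotone_sortKey (Ω : Superpartition N m) :
    Monotone (sortKey m Ω.parts) := by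
  intro i j hij
  rw [sortKey_le_iff]
  rcases lt_or_ge (j : ℕ) m with hj | hj
  · have hi : (i : ℕ) < m := lt_of_le_of_lt hij hj
    refine Or.inr ⟨iff_of_true hi hj, ?_⟩
    rcases hij.eq_or_lt with rfl | hlt
    · exact le_rfl
    · exact (Ω.anti i j hlt hj).le
  · rcases lt_or_ge (i : ℕ) m with hi | hi
    · exact Or.inl ⟨hi, hj⟩
    · exact Or.inr ⟨iff_of_false hi.not_gt hj.not_gt, Ω.symm i j hi hij⟩

theorem Superpartition.injOn (Ω : Superpartition N m) {i j : Fin N} (hi : (i : ℕ) < m)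
    (hj : (j : ℕ) < m) (h : Ω.parts i = Ω.parts j) : i = j := by
  rcases lt_trichotomy i j with hlt | rfl | hlt
  · exact absurd h (Ω.anti i j hlt hj).ne'
  · rfl
  · exact absurd h (Ω.anti j i hlt hi).ne

theorem eq_of_monotone_comp {α : Type*} [LinearOrder α] {f : Fin N → α}
    (τ : Equiv.Perm (Fin N)) (hf : Monotone f) (hτ : Monotone (f ∘ τ)) : f ∘ τ = f := by
  rw [Tuple.comp_sort_eq_comp_iff_monotone.2 hτ]
  exact (Tuple.comp_sort_eq_comp_iff_monotone (σ := 1).2 hf).symm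

/-- `σs` is not unique when symmetric parts repeat, but `σa` is, because the fermionic parts of `Ω`
are distinct. Hence the sign in the coefficient is well defined. -/
theorem IsRearrangement.unique {γ : Fin N → ℕ} {Ω Ω' : Superpartition N m}
    {σa σs σa' σs' : Equiv.Perm (Fin N)} (h : IsRearrangement γ Ω σa σs)
    (h' : IsRearrangement γ Ω' σa' σs') : Ω = Ω' ∧ σa = σa' := by
  have hΩ : Ω = Ω' := by
    set τ := σa * σs with hτ
    set τ' := σa' * σs' with hτ'
    have hk : sortKey m Ω'.parts ∘ (τ' * τ⁻¹ : Equiv.Perm (Fin N)) = sortKey m Ω.parts := by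
      funext k
      obtain ⟨l, rfl⟩ := τ.surjective k
      have h0 : (τ' * τ⁻¹ : Equiv.Perm (Fin N)) (τ l) = τ' l := by simp
      rw [Function.comp_apply, h0]
      unfold sortKey
      have h1 : Ω'.parts (τ' l) = γ l := h'.sends l
      have h2 : Ω.parts (τ l) = γ l := h.sends l
      have h3 : ((τ' l : ℕ) < m) = ((τ l : ℕ) < m) :=
        propext ((h'.lt_iff l).trans (h.lt_iff l).symm)
      simp only [h1, h2, h3]
    have he := eq_of_monotone_comp _ Ω'.monotone_sortKey
      (by rw [hk]; exact Ω.monotone_sortKey)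
    rw [hk] at he
    ext k
    have := congrFun he k
    have h1 := (sortKey_le_iff (m := m) Ω.parts Ω'.parts k k).1 this.le
    have h2 := (sortKey_le_iff (m := m) Ω'.parts Ω.parts k k).1 this.ge
    omega
  subst hΩ
  refine ⟨rfl, Equiv.ext fun k => ?_⟩
  rcases lt_or_ge (k : ℕ) m with hk | hk
  · have h1 := h.sends k
    have h2 := h'.sends k
    rw [Equiv.Perm.mul_apply, h.fix_s k hk] at h1
    rw [Equiv.Perm.mul_apply, h'.fix_s k hk] at h2
    exact Ω.injOn ((lt_iff_of_fix_ge h.fix_a k).2 hk) ((lt_iff_of_fix_ge h'.fix_a k).2 hk)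
      (h1.trans h2.symm)
  · rw [h.fix_a k hk, h'.fix_a k hk]

theorem exists_isRearrangement (hm : m ≤ N) (γ : Fin N → ℕ)
    (hγ : ∀ i j : Fin N, (i : ℕ) < m → (j : ℕ) < m → γ i = γ j → i = j) :
    ∃ (Ω : Superpartition N m) (σa σs : Equiv.Perm (Fin N)), IsRearrangement γ Ω σa σs := by
  set τ := Tuple.sort (sortKey m γ)
  have hmono : Monotone (sortKey m γ ∘ τ) := Tuple.monotone_sort _
  have hb (k : Fin N) : (τ k : ℕ) < m ↔ (k : ℕ) < m := by
    -- The block indicator is monotone both before and after the sort, so the sort maps each block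
    -- to itself.
    have := eq_of_monotone_comp (f := fun k : Fin N => if (k : ℕ) < m then 0 else 1) τ
      (by
        intro i j hij
        have : (i : ℕ) ≤ j := hij
        dsimp only
        split_ifs <;> omega)
      (by
        intro i j hij
        have := (sortKey_le_iff γ γ (τ i) (τ j)).1 (hmono hij)
        dsimp only [Function.comp_apply]
        split_ifs <;> omega)
    have := congrFun this k
    simp only [Function.comp_apply] at this
    split_ifs at this <;> omega
  have hord (i j : Fin N) (hij : i ≤ j) (hbl : (i : ℕ) < m ↔ (j : ℕ) < m) :
      γ (τ j) ≤ γ (τ i) := by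
    have h := (sortKey_le_iff γ γ (τ i) (τ j)).1 (hmono hij)
    have h1 := hb i
    have h2 := hb j
    omega
  let Ω : Superpartition N m :=
    { parts := γ ∘ τ
      m_le := hm
      anti := fun i j hij hj => by
        have hij' : (i : ℕ) < j := hij
        have hi : (i : ℕ) < m := hij'.trans hj
        refine lt_of_le_of_ne (hord i j hij.le (by simp [hi, hj])) fun he => ?_
        exact hij.ne (τ.injective (hγ _ _ ((hb i).2 hi) ((hb j).2 hj) he.symm))
      symm := fun i j hi hij => by
        have hij' : (i : ℕ) ≤ j := hij
        exact hord i j hij (by omega) }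
  have hbi (k : Fin N) : (τ⁻¹ k : ℕ) < m ↔ (k : ℕ) < m := by
    rw [← hb, ← Equiv.Perm.mul_apply, mul_inv_cancel, Equiv.Perm.one_apply]
  -- `τ⁻¹` preserves both blocks; its two restrictions, extended by the identity, serve as `σa` and
  -- `σs`.
  refine ⟨Ω, Equiv.Perm.ofSubtype ((τ⁻¹).subtypePerm (p := fun k : Fin N => (k : ℕ) < m) hbi),
    Equiv.Perm.ofSubtype ((τ⁻¹).subtypePerm (p := fun k : Fin N => ¬ (k : ℕ) < m)
      fun k => not_congr (hbi k)), ?_, ?_, ?_⟩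
  · exact fun k hk => Equiv.Perm.ofSubtype_apply_of_not_mem _ (not_lt.2 hk)
  · exact fun k hk => Equiv.Perm.ofSubtype_apply_of_not_mem _ (not_not.2 hk)
  · intro k
    have hΩ (l : Fin N) : Ω.parts l = γ (τ l) := rfl
    have : (Equiv.Perm.ofSubtype
        ((τ⁻¹).subtypePerm (p := fun k : Fin N => (k : ℕ) < m) hbi) *
        Equiv.Perm.ofSubtype ((τ⁻¹).subtypePerm (p := fun k : Fin N => ¬ (k : ℕ) < m)
          fun k => not_congr (hbi k))) k = τ⁻¹ k := by
      rw [Equiv.Perm.mul_apply]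
      by_cases hk : (k : ℕ) < m
      · rw [Equiv.Perm.ofSubtype_apply_of_not_mem (p := fun k : Fin N => ¬ (k : ℕ) < m) _
          (not_not.2 hk), Equiv.Perm.ofSubtype_apply_of_mem (p := fun k : Fin N => (k : ℕ) < m) _ hk]
        rfl
      · rw [Equiv.Perm.ofSubtype_apply_of_mem (p := fun k : Fin N => ¬ (k : ℕ) < m) _ hk,
          Equiv.Perm.ofSubtype_apply_of_not_mem]
        · rfl
        · simpa [Equiv.Perm.subtypePerm_apply] using fun h => hk ((hbi k).1 h)
    rw [this, hΩ, ← Equiv.Perm.mul_apply, mul_inv_cancel, Equiv.Perm.one_apply]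

open Classical in
/-- The expansion of `orbitSum γ` on the monomial superfunctions: one term, or none. -/
def orbitCoeff (𝕜 : Type*) [Field 𝕜] (m : ℕ) (γ : Fin N → ℕ) : Superpartition N m →₀ 𝕜 :=
  if h : ∃ (Ω : Superpartition N m) (σa σs : Equiv.Perm (Fin N)), IsRearrangement γ Ω σa σs then
    Finsupp.single h.choose
      (((Equiv.Perm.sign h.choose_spec.choose : ℤ) : 𝕜) * h.choose.norm)
  else 0

theorem IsRearrangement.orbitCoeff_eq {γ : Fin N → ℕ} {Ω : Superpartition N m}
    {σa σs : Equiv.Perm (Fin N)} (h : IsRearrangement γ Ω σa σs) :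
    orbitCoeff 𝕜 m γ = Finsupp.single Ω (((Equiv.Perm.sign σa : ℤ) : 𝕜) * Ω.norm) := by
  have hex : ∃ (Ω : Superpartition N m) (σa σs : Equiv.Perm (Fin N)),
    IsRearrangement γ Ω σa σs := ⟨Ω, σa, σs, h⟩
  obtain ⟨h1, h2⟩ := hex.choose_spec.choose_spec.choose_spec.unique h
  rw [orbitCoeff, dif_pos hex, h2, h1]

theorem exists_isRearrangement_of_orbitCoeff_ne_zero {γ : Fin N → ℕ} {Ω : Superpartition N m}
    (h : orbitCoeff 𝕜 m γ Ω ≠ 0) :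
    ∃ σa σs : Equiv.Perm (Fin N), IsRearrangement γ Ω σa σs := by
  classical
  by_cases hex : ∃ (Ω : Superpartition N m) (σa σs : Equiv.Perm (Fin N)),
      IsRearrangement γ Ω σa σs
  · obtain ⟨Ω', σa, σs, hr⟩ := hex
    rw [hr.orbitCoeff_eq, Finsupp.single_apply] at h
    split_ifs at h with he
    · exact ⟨σa, σs, he ▸ hr⟩
    · exact absurd rfl h
  · simp [orbitCoeff, hex] at h

theorem linearCombination_orbitCoeff [CharZero 𝕜] (hm : m ≤ N) (γ : Fin N → ℕ) :
    Finsupp.linearCombination 𝕜 (Superpartition.monomial 𝕜) (orbitCoeff 𝕜 m γ) =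
      orbitSum 𝕜 hm γ := by
  by_cases hγ : ∀ i j : Fin N, (i : ℕ) < m → (j : ℕ) < m → γ i = γ j → i = j
  · obtain ⟨Ω, σa, σs, h⟩ := exists_isRearrangement hm γ hγ
    rw [h.orbitCoeff_eq, Finsupp.linearCombination_single, h.orbitSum_eq]
  · push Not at hγ
    obtain ⟨i, j, hi, hj, he, hij⟩ := hγ
    rw [orbitSum_eq_zero hm γ hij hi hj he]
    have : orbitCoeff 𝕜 m γ = 0 := by
      by_contra hne
      obtain ⟨Ω, hΩ⟩ := Finsupp.ne_iff.1 hne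
      obtain ⟨σa, σs, h⟩ := exists_isRearrangement_of_orbitCoeff_ne_zero hΩ
      have : Ω.parts (σa i) = Ω.parts (σa j) := by
        have h1 := h.sends i
        have h2 := h.sends j
        rw [Equiv.Perm.mul_apply, h.fix_s i hi] at h1
        rw [Equiv.Perm.mul_apply, h.fix_s j hj] at h2
        rw [h1, h2, he]
      exact hij (σa.injective (Ω.injOn ((lt_iff_of_fix_ge h.fix_a i).2 hi)
        ((lt_iff_of_fix_ge h.fix_a j).2 hj) this))
    rw [this, map_zero]

end Rearrangement

/-! ### Folding of intensities, the eigenvalue and the expansion of the Hamiltonian -/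

section Expansion

variable {𝕜 : Type*} [Field 𝕜] {N m : ℕ}

/-- Intensities beyond the midpoint are reflected by `l ↦ d - l`, after which their weight is `l`;
at the midpoint `d - l = l`. -/
theorem sum_Ioo_reflect {A : Type*} [AddCommGroup A] [Module 𝕜 A] (d : ℕ) (f : ℕ → A) :
    ∑ l ∈ Finset.Ioo 0 d, ((d : 𝕜) - l) • f l =
      ∑ l ∈ Finset.Ioo 0 d with 2 * l < d, (((d : 𝕜) - l) • f l + (l : 𝕜) • f (d - l)) +
        ∑ l ∈ Finset.Ioo 0 d with 2 * l = d, (l : 𝕜) • f l := by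
  rw [← Finset.sum_filter_add_sum_filter_not (Finset.Ioo 0 d) (fun l => 2 * l < d),
    Finset.sum_add_distrib, add_assoc]
  congr 1
  rw [← Finset.sum_filter_add_sum_filter_not _ (fun l => 2 * l = d), add_comm]
  congr 1
  · refine Finset.sum_nbij' (fun l => d - l) (fun l => d - l) ?_ ?_ ?_ ?_ ?_
    · intro l; simp only [Finset.mem_filter, Finset.mem_Ioo]; omega
    · intro l; simp only [Finset.mem_filter, Finset.mem_Ioo]; omega
    · intro l; simp only [Finset.mem_filter, Finset.mem_Ioo]; omega
    · intro l; simp only [Finset.mem_filter, Finset.mem_Ioo]; omega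
    · intro l hl
      simp only [Finset.mem_filter, Finset.mem_Ioo] at hl
      rw [Nat.sub_sub_self (by omega), Nat.cast_sub (by omega)]
  · refine Finset.sum_congr ?_ fun l hl => ?_
    · ext l; simp only [Finset.mem_filter, Finset.mem_Ioo]; omega
    · simp only [Finset.mem_filter, Finset.mem_Ioo] at hl
      rw [← hl.2]
      push_cast
      congr 1
      ring

theorem sum_Ioo_of_reflect_neg [CharZero 𝕜] {A : Type*} [AddCommGroup A] [Module 𝕜 A] (d : ℕ)
    (f : ℕ → A) (hf : ∀ l ≤ d, f (d - l) = -f l) :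
    ∑ l ∈ Finset.Ioo 0 d, ((d : 𝕜) - l) • f l =
      ∑ l ∈ Finset.Ioo 0 d with 2 * l < d, ((d : 𝕜) - 2 * l) • f l := by
  rw [sum_Ioo_reflect, Finset.sum_eq_zero (s := {l ∈ Finset.Ioo 0 d | 2 * l = d}), add_zero]
  · refine Finset.sum_congr rfl fun l hl => ?_
    simp only [Finset.mem_filter, Finset.mem_Ioo] at hl
    rw [hf l (by omega), smul_neg, ← sub_eq_add_neg, ← sub_smul]
    congr 1
    ring
  · intro l hl
    simp only [Finset.mem_filter, Finset.mem_Ioo] at hl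
    have h := hf l (by omega)
    -- The midpoint term equals its own negative, so it vanishes.
    rw [show d - l = l by omega, eq_neg_iff_add_eq_zero, ← two_smul 𝕜] at h
    rw [(smul_eq_zero.1 h).resolve_left two_ne_zero, smul_zero]

theorem sum_Ioo_of_reflect_eq [CharZero 𝕜] {A : Type*} [AddCommGroup A] [Module 𝕜 A] (d : ℕ)
    (f : ℕ → A) (hf : ∀ l ≤ d, f (d - l) = f l) :
    ∑ l ∈ Finset.Ioo 0 d, ((d : 𝕜) - l) • f l =
      ∑ l ∈ Finset.Ioo 0 d with 2 * l ≤ d, ((d : 𝕜) * if 2 * l = d then 1 / 2 else 1) • f l := by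
  rw [sum_Ioo_reflect,
    ← Finset.sum_filter_add_sum_filter_not {l ∈ Finset.Ioo 0 d | 2 * l ≤ d} (fun l => 2 * l < d),
    Finset.filter_filter, Finset.filter_filter]
  congr 1
  · refine Finset.sum_congr ?_ fun l hl => ?_
    · ext l; simp only [Finset.mem_filter, Finset.mem_Ioo]; omega
    · simp only [Finset.mem_filter, Finset.mem_Ioo] at hl
      rw [hf l (by omega), ← add_smul, if_neg (by omega)]
      congr 1
      ring
  · refine Finset.sum_congr ?_ fun l hl => ?_
    · ext l; simp only [Finset.mem_filter, Finset.mem_Ioo]; omega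
    · simp only [Finset.mem_filter, Finset.mem_Ioo] at hl
      rw [if_pos (by omega), show (d : 𝕜) = (2 * l : ℕ) by congr 1; omega]
      congr 1
      push_cast
      ring

/-- This is the symmetry behind the folding. For types I and III the swap stays in one block and
gives a sign or nothing; for type II it mixes the blocks, so no intensities are identified. -/
theorem transfer_gap_sub (γ : Fin N → ℕ) {i j : Fin N} (hij : i ≠ j) {l : ℕ}
    (hl : l ≤ gap γ i j) :
    transfer γ i j (gap γ i j - l) = transfer γ i j l ∘ Equiv.swap i j := by
  unfold gap at *
  funext k
  rw [Function.comp_apply]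
  rcases eq_or_ne k i with rfl | hki
  · rw [Equiv.swap_apply_left, transfer_left _ _ hij, transfer_right]
    split_ifs <;> omega
  rcases eq_or_ne k j with rfl | hkj
  · rw [Equiv.swap_apply_right, transfer_left _ _ hij, transfer_right]
    split_ifs <;> omega
  · rw [Equiv.swap_apply_of_ne_of_ne hki hkj, transfer_of_ne _ _ hki hkj,
      transfer_of_ne _ _ hki hkj]

/-- The intensities `l` for which a lowering operator acts non-trivially on the positions
`i < j` of `Λ`. -/
def intensities (Λ : Superpartition N m) (i j : Fin N) : Finset ℕ :=
  match pairType m i j with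
  | .I => {l ∈ Finset.Ioo 0 (gap Λ.parts i j) | 2 * l < gap Λ.parts i j}
  | .II => Finset.Ioo 0 (gap Λ.parts i j)
  | .III => {l ∈ Finset.Ioo 0 (gap Λ.parts i j) | 2 * l ≤ gap Λ.parts i j}

/-- The coefficient of the orbit sum with intensity `l` in the contribution of two positions of
the given type whose parts differ by `d`. -/
def PairType.weight (𝕜 : Type*) [Field 𝕜] (d l : ℕ) : PairType → 𝕜
  | .I => (d : 𝕜) - 2 * l
  | .II => (d : 𝕜) - l
  | .III => (d : 𝕜) * if 2 * l = d then 1 / 2 else 1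

theorem sum_orbitSum_transfer [CharZero 𝕜] (Λ : Superpartition N m) {i j : Fin N} (hij : i < j) :
    ∑ l ∈ Finset.Ioo 0 (gap Λ.parts i j),
        ((gap Λ.parts i j : 𝕜) - l) • orbitSum 𝕜 Λ.m_le (transfer Λ.parts i j l) =
      ∑ l ∈ intensities Λ i j, (pairType m i j).weight 𝕜 (gap Λ.parts i j) l •
        orbitSum 𝕜 Λ.m_le (transfer Λ.parts i j l) := by
  have hij' : (i : ℕ) < j := hij
  unfold intensities
  by_cases hj : (j : ℕ) < m
  · have ht : pairType m i j = .I := if_pos hj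
    rw [ht]
    exact sum_Ioo_of_reflect_neg _
      (fun l => orbitSum 𝕜 Λ.m_le (transfer Λ.parts i j l)) fun l hl => by
      rw [transfer_gap_sub _ hij.ne hl, orbitSum_comp_swap_lt _ _ hij.ne (hij'.trans hj) hj]
  · by_cases hi : (i : ℕ) < m
    · have ht : pairType m i j = .II := by rw [pairType, if_neg hj, if_pos hi]
      simp only [ht, PairType.weight]
    · have ht : pairType m i j = .III := by rw [pairType, if_neg hj, if_neg hi]
      rw [ht]
      exact sum_Ioo_of_reflect_eq _
        (fun l => orbitSum 𝕜 Λ.m_le (transfer Λ.parts i j l)) fun l hl => by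
        rw [transfer_gap_sub _ hij.ne hl,
          orbitSum_comp_swap_ge _ _ (not_lt.1 hi) (not_lt.1 hj)]

/-- With positions counted from `0`, `s j` occurs `N - 1 - j` times with a plus sign and `j` times
with a minus sign. -/
theorem sum_Ioi_sub (s : Fin N → 𝕜) :
    ∑ i, ∑ j ∈ Finset.Ioi i, (s i - s j) =
      ∑ j : Fin N, ((N : 𝕜) + 1 - 2 * (((j : ℕ) : 𝕜) + 1)) * s j := by
  simp only [Finset.sum_sub_distrib]
  rw [Finset.sum_comm' (s := Finset.univ) (t := fun i : Fin N => Finset.Ioi i)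
    (t' := Finset.univ) (s' := fun j => Finset.Iio j) (f := fun _ j => s j)
    (by simp), ← Finset.sum_sub_distrib]
  refine Finset.sum_congr rfl fun j _ => ?_
  simp only [Finset.sum_const, Fin.card_Ioi, Fin.card_Iio, nsmul_eq_mul]
  have hj : ((N - 1 - (j : ℕ) : ℕ) : 𝕜) = N - 1 - (j : ℕ) := by
    have := j.isLt
    rw [Nat.sub_sub, Nat.cast_sub (by omega)]
    push_cast
    ring
  rw [hj]
  ring

/-- Both sums are symmetric in the positions, so they may be evaluated on the sorted sequence, where
every gap is an honest difference. -/
theorem eigenvalue_eq [CharZero 𝕜] (β : 𝕜) (Λ : Superpartition N m) :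
    ∑ i, (Λ.parts i : 𝕜) ^ 2 + β * ∑ i, ∑ j ∈ Finset.Ioi i, (gap Λ.parts i j : 𝕜) =
      Λ.eigenvalue β := by
  set τ := Tuple.sort (fun k => OrderDual.toDual (Λ.parts k)) with hτ
  have hstar (k : Fin N) : Λ.star k = Λ.parts (τ k) := rfl
  have hanti (i j : Fin N) (h : i ≤ j) : Λ.star j ≤ Λ.star i :=
    Tuple.monotone_sort (fun k => OrderDual.toDual (Λ.parts k)) h
  have h1 : ∑ i, (Λ.parts i : 𝕜) ^ 2 = ∑ i, (Λ.star i : 𝕜) ^ 2 :=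
    (Equiv.sum_comp τ fun i => (Λ.parts i : 𝕜) ^ 2).symm
  have h2 : ∑ i, ∑ j ∈ Finset.Ioi i, (gap Λ.parts i j : 𝕜) =
      ∑ i, ∑ j ∈ Finset.Ioi i, ((Λ.star i : 𝕜) - Λ.star j) := by
    rw [← sum_Ioi_perm (𝕜 := 𝕜) (fun i j => (gap Λ.parts i j : 𝕜))
      (fun i j => by unfold gap; rw [add_comm]) τ]
    refine Finset.sum_congr rfl fun i _ => Finset.sum_congr rfl fun j hj => ?_
    have := hanti i j (Finset.mem_Ioi.1 hj).le
    rw [hstar, hstar] at *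
    rw [← Nat.cast_sub this]
    congr 1
    unfold gap
    omega
  rw [h1, h2, sum_Ioi_sub, Finset.mul_sum, ← Finset.sum_add_distrib, Superpartition.eigenvalue]
  refine Finset.sum_congr rfl fun j _ => ?_
  ring

/-- The off-diagonal coefficients of the Hamiltonian in the basis of monomial superfunctions. -/
def offDiagonal (β : 𝕜) (Λ : Superpartition N m) : Superpartition N m →₀ 𝕜 :=
  (2 * β * (Λ.norm : 𝕜)⁻¹) • ∑ i, ∑ j ∈ Finset.Ioi i, ∑ l ∈ intensities Λ i j,
    (pairType m i j).weight 𝕜 (gap Λ.parts i j) l •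
      orbitCoeff 𝕜 m (transfer Λ.parts i j l)

theorem hamiltonian_monomial [CharZero 𝕜] (β : 𝕜) (Λ : Superpartition N m) :
    hamiltonian β (Λ.monomial 𝕜) = Λ.eigenvalue β • Λ.monomial 𝕜 +
      Finsupp.linearCombination 𝕜 (Superpartition.monomial 𝕜) (offDiagonal β Λ) := by
  have hL : Finsupp.linearCombination 𝕜 (Superpartition.monomial 𝕜) (offDiagonal β Λ) =
      (2 * β * (Λ.norm : 𝕜)⁻¹) • ∑ i, ∑ j ∈ Finset.Ioi i, ∑ l ∈ Finset.Ioo 0 (gap Λ.parts i j),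
          ((gap Λ.parts i j : 𝕜) - l) • orbitSum 𝕜 Λ.m_le (transfer Λ.parts i j l) := by
    simp only [offDiagonal, map_smul, map_sum, linearCombination_orbitCoeff Λ.m_le]
    refine congrArg _ (Finset.sum_congr rfl fun i _ => Finset.sum_congr rfl fun j hj => ?_)
    exact (sum_orbitSum_transfer Λ (Finset.mem_Ioi.1 hj)).symm
  rw [hL, Superpartition.monomial, sum_term, map_smul, hamiltonian_orbitSum, eigenvalue_eq,
    smul_add, smul_smul, smul_smul, smul_smul, mul_comm _ (Λ.eigenvalue β),
    mul_comm _ (2 * β)]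

end Expansion

/-! ### Recovering the lowering operator from the contents of the two blocks -/

section Counting

variable {N m : ℕ}

/-- The number of positions satisfying `P` at which `γ` takes the value `x`. -/
def countOn (P : Fin N → Prop) [DecidablePred P] (γ : Fin N → ℕ) (x : ℕ) : ℕ :=
  (Finset.univ.filter fun k => P k ∧ γ k = x).card

theorem countOn_comp (P : Fin N → Prop) [DecidablePred P] (γ : Fin N → ℕ)
    (τ : Equiv.Perm (Fin N)) (hτ : ∀ k, P (τ k) ↔ P k) (x : ℕ) :
    countOn P (γ ∘ τ) x = countOn P γ x :=
  Finset.card_equiv τ (by simp [hτ])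

theorem countOn_eq (P : Fin N → Prop) [DecidablePred P] (γ : Fin N → ℕ) {i j : Fin N}
    (hij : i ≠ j) (x : ℕ) :
    countOn P γ x = (if P i ∧ γ i = x then 1 else 0) + (if P j ∧ γ j = x then 1 else 0) +
      ∑ k ∈ (Finset.univ.erase i).erase j, if P k ∧ γ k = x then 1 else 0 := by
  rw [countOn, Finset.card_filter, ← Finset.add_sum_erase _ _ (Finset.mem_univ i), add_assoc,
    Finset.add_sum_erase _ (fun k => if P k ∧ γ k = x then 1 else 0)
      (Finset.mem_erase.2 ⟨hij.symm, Finset.mem_univ j⟩)]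

/-- Old values are added on one side and new values on the other, which avoids truncated
subtraction. -/
theorem countOn_transfer (P : Fin N → Prop) [DecidablePred P] (γ : Fin N → ℕ) {i j : Fin N}
    (hij : i ≠ j) (l x : ℕ) :
    countOn P (transfer γ i j l) x + (if P i ∧ γ i = x then 1 else 0) +
        (if P j ∧ γ j = x then 1 else 0) =
      countOn P γ x + (if P i ∧ transfer γ i j l i = x then 1 else 0) +
        (if P j ∧ transfer γ i j l j = x then 1 else 0) := by
  rw [countOn_eq P γ hij, countOn_eq P (transfer γ i j l) hij]
  have : ∑ k ∈ (Finset.univ.erase i).erase j, (if P k ∧ transfer γ i j l k = x then 1 else 0) =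
      ∑ k ∈ (Finset.univ.erase i).erase j, if P k ∧ γ k = x then 1 else 0 := by
    refine Finset.sum_congr rfl fun k hk => ?_
    simp only [Finset.mem_erase] at hk
    rw [transfer_of_ne γ l hk.2.1 hk.1]
  omega

theorem eq_of_indicator_single {p p' q q' : ℕ} (hp : p ≠ p')
    (h : ∀ x, (if p' = x then 1 else 0) + (if q = x then 1 else 0) =
      (if q' = x then 1 else 0) + (if p = x then 1 else 0)) : p = q ∧ p' = q' := by
  have h1 := h p
  have h2 := h p'
  split_ifs at h1 h2 <;> omega

/-- The hypothesis is an equality of multisets. Neither `a` nor `b` is among `a - l`, `b + l`, so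
each is `c` or `d`, and `b < a`, `d < c` fix the matching. -/
theorem eq_of_indicator_pair {a b l c d k : ℕ} (hl : 0 < l) (hk : 0 < k)
    (hab : b + 2 * l ≤ a) (hcd : d + 2 * k ≤ c)
    (h : ∀ x, (if a - l = x then 1 else 0) + (if b + l = x then 1 else 0) +
        ((if c = x then 1 else 0) + (if d = x then 1 else 0)) =
      (if c - k = x then 1 else 0) + (if d + k = x then 1 else 0) +
        ((if a = x then 1 else 0) + (if b = x then 1 else 0))) : a = c ∧ b = d ∧ l = k := by
  have ha : a = c ∨ a = d := by
    have h1 := h a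
    rw [if_neg (by omega), if_neg (by omega), if_pos rfl] at h1
    split_ifs at h1 <;> omega
  have hb : b = c ∨ b = d := by
    have h1 := h b
    rw [if_neg (by omega), if_neg (by omega), if_pos rfl] at h1
    split_ifs at h1 <;> omega
  have hac : a = c := by omega
  have hbd : b = d := by omega
  subst hac hbd
  -- Either `a - l = a - k`, or `l + k = a - b`, where both `l` and `k` are at most half of `a - b`;
  -- in each case `l = k`.
  have h1 := h (a - l)
  rw [if_pos rfl] at h1
  refine ⟨rfl, rfl, ?_⟩
  split_ifs at h1 <;> omega

theorem pos_and_lt_gap {Λ : Superpartition N m} {i j : Fin N} {l : ℕ}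
    (h : l ∈ intensities Λ i j) : 0 < l ∧ l < gap Λ.parts i j := by
  unfold intensities at h
  split at h <;> simp only [Finset.mem_filter, Finset.mem_Ioo] at h <;> omega

theorem le_of_same_block {Λ : Superpartition N m} {i j : Fin N} (hij : i < j)
    (h : (i : ℕ) < m ↔ (j : ℕ) < m) : Λ.parts j ≤ Λ.parts i := by
  by_cases hi : (i : ℕ) < m
  · exact (Λ.anti i j hij (h.1 hi)).le
  · exact Λ.symm i j (not_lt.1 hi) hij.le

theorem add_two_mul_le {Λ : Superpartition N m} {i j : Fin N} {l : ℕ} (hij : i < j)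
    (hb : (i : ℕ) < m ↔ (j : ℕ) < m) (h : l ∈ intensities Λ i j) :
    Λ.parts j + 2 * l ≤ Λ.parts i := by
  have hle := le_of_same_block (Λ := Λ) hij hb
  have hg : gap Λ.parts i j = Λ.parts i - Λ.parts j := by unfold gap; omega
  unfold intensities pairType at h
  by_cases hj : (j : ℕ) < m
  · rw [if_pos hj] at h
    simp only [Finset.mem_filter, Finset.mem_Ioo] at h
    omega
  · rw [if_neg hj, if_neg (mt hb.1 hj)] at h
    simp only [Finset.mem_filter, Finset.mem_Ioo] at h
    omega

theorem transfer_of_same_block {Λ : Superpartition N m} {i j : Fin N} {l : ℕ} (hij : i < j)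
    (hb : (i : ℕ) < m ↔ (j : ℕ) < m) (h : l ∈ intensities Λ i j) :
    transfer Λ.parts i j l i = Λ.parts i - l ∧ transfer Λ.parts i j l j = Λ.parts j + l := by
  have h1 := add_two_mul_le hij hb h
  have h2 := (pos_and_lt_gap h).1
  rw [transfer_left _ _ hij.ne, transfer_right, if_pos (by omega), if_pos (by omega)]
  exact ⟨rfl, rfl⟩

theorem transfer_ne {Λ : Superpartition N m} {i j : Fin N} {l : ℕ} (hij : i < j)
    (h : l ∈ intensities Λ i j) :
    Λ.parts i ≠ transfer Λ.parts i j l i ∧ Λ.parts j ≠ transfer Λ.parts i j l j := by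
  have h2 := pos_and_lt_gap h
  rw [transfer_left _ _ hij.ne, transfer_right]
  unfold gap at h2
  split_ifs <;> omega

theorem pairType_eq_iff {i j i' j' : Fin N} (hij : i < j) (hij' : i' < j') :
    pairType m i j = pairType m i' j' ↔
      (((i : ℕ) < m ↔ (i' : ℕ) < m) ∧ ((j : ℕ) < m ↔ (j' : ℕ) < m)) := by
  have h : (i : ℕ) < j := hij
  have h' : (i' : ℕ) < j' := hij'
  unfold pairType
  split_ifs <;> simp only [true_iff, false_iff] <;> omega

/-- The content of the two blocks of `R_{ij}^{(l)} Λ` determines the type of `(i, j)`, the parts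
`Λ i` and `Λ j`, and `l`. -/
theorem eq_of_countOn_transfer_eq {Λ : Superpartition N m} {i j i' j' : Fin N} {l l' : ℕ}
    (hij : i < j) (hij' : i' < j') (hl : l ∈ intensities Λ i j) (hl' : l' ∈ intensities Λ i' j')
    (hA : ∀ x, countOn (fun k : Fin N => (k : ℕ) < m) (transfer Λ.parts i j l) x =
      countOn (fun k : Fin N => (k : ℕ) < m) (transfer Λ.parts i' j' l') x)
    (hS : ∀ x, countOn (fun k : Fin N => m ≤ (k : ℕ)) (transfer Λ.parts i j l) x =
      countOn (fun k : Fin N => m ≤ (k : ℕ)) (transfer Λ.parts i' j' l') x) :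
    pairType m i j = pairType m i' j' ∧ Λ.parts i = Λ.parts i' ∧ Λ.parts j = Λ.parts j' ∧
      l = l' := by
  have hv : (i : ℕ) < j := hij
  have hv' : (i' : ℕ) < j' := hij'
  have hA1 := countOn_transfer (fun k : Fin N => (k : ℕ) < m) Λ.parts hij.ne l
  have hA2 := countOn_transfer (fun k : Fin N => (k : ℕ) < m) Λ.parts hij'.ne l'
  have hS1 := countOn_transfer (fun k : Fin N => m ≤ (k : ℕ)) Λ.parts hij.ne l
  have hS2 := countOn_transfer (fun k : Fin N => m ≤ (k : ℕ)) Λ.parts hij'.ne l'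
  have hn := transfer_ne hij hl
  have hn' := transfer_ne hij' hl'
  have hp := pos_and_lt_gap hl
  have hp' := pos_and_lt_gap hl'
  have hsame (i j : Fin N) (l : ℕ) (hij : i < j) (hl : l ∈ intensities Λ i j)
      (hb : (i : ℕ) < m ↔ (j : ℕ) < m) : Λ.parts i ≠ Λ.parts j ∧
      transfer Λ.parts i j l j ≠ Λ.parts i := by
    have h1 := add_two_mul_le hij hb hl
    have h2 := (pos_and_lt_gap hl).1
    rw [(transfer_of_same_block hij hb hl).2]
    omega
  have hII (i j : Fin N) (l : ℕ) (hij : i < j) (hl : l ∈ intensities Λ i j) (f : ℕ → ℕ)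
      (hf : ∀ x, f x + (if Λ.parts i = x then 1 else 0) =
        f x + (if transfer Λ.parts i j l i = x then 1 else 0)) : False := by
    have h1 := hf (Λ.parts i)
    rw [if_pos rfl, if_neg (transfer_ne hij hl).1.symm] at h1
    omega
  have hII' (i j : Fin N) (l : ℕ) (hij : i < j) (hl : l ∈ intensities Λ i j) (f : ℕ → ℕ)
      (hf : ∀ x, f x + (if Λ.parts j = x then 1 else 0) =
        f x + (if transfer Λ.parts i j l j = x then 1 else 0)) : False := by
    have h1 := hf (Λ.parts j)
    rw [if_pos rfl, if_neg (transfer_ne hij hl).2.symm] at h1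
    omega
  have hIII (i j : Fin N) (l : ℕ) (hij : i < j) (hl : l ∈ intensities Λ i j)
      (hb : (i : ℕ) < m ↔ (j : ℕ) < m) (f : ℕ → ℕ)
      (hf : ∀ x, f x + (if Λ.parts i = x then 1 else 0) + (if Λ.parts j = x then 1 else 0) =
        f x + (if transfer Λ.parts i j l i = x then 1 else 0) +
          (if transfer Λ.parts i j l j = x then 1 else 0)) : False := by
    have h1 := hf (Λ.parts i)
    rw [if_pos rfl, if_neg (transfer_ne hij hl).1.symm, if_neg (hsame i j l hij hl hb).2] at h1
    omega
  have hpair (hb : (i : ℕ) < m ↔ (j : ℕ) < m) (hb' : (i' : ℕ) < m ↔ (j' : ℕ) < m)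
      (h : ∀ x, (if transfer Λ.parts i j l i = x then 1 else 0) +
          (if transfer Λ.parts i j l j = x then 1 else 0) +
          ((if Λ.parts i' = x then 1 else 0) + (if Λ.parts j' = x then 1 else 0)) =
        (if transfer Λ.parts i' j' l' i' = x then 1 else 0) +
          (if transfer Λ.parts i' j' l' j' = x then 1 else 0) +
          ((if Λ.parts i = x then 1 else 0) + (if Λ.parts j = x then 1 else 0))) :
      Λ.parts i = Λ.parts i' ∧ Λ.parts j = Λ.parts j' ∧ l = l' := by
    simp only [transfer_of_same_block hij hb hl, transfer_of_same_block hij' hb' hl'] at h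
    exact eq_of_indicator_pair hp.1 hp'.1 (add_two_mul_le hij hb hl)
      (add_two_mul_le hij' hb' hl') h
  rw [pairType_eq_iff hij hij']
  -- Nine combinations are compatible with `i < j` and `i' < j'`. In the six with different types,
  -- one operator leaves the content of some block unchanged while the other visibly alters it.
  by_cases hi : (i : ℕ) < m <;> by_cases hj : (j : ℕ) < m <;>
    by_cases hi' : (i' : ℕ) < m <;> by_cases hj' : (j' : ℕ) < m <;> (try omega) <;>
    simp only [hi, hj, hi', hj', true_and, false_and, if_false, add_zero, not_le.2, not_lt.1,
      not_false_eq_true, iff_self] at hA1 hA2 hS1 hS2 ⊢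
  · exact hpair (iff_of_true hi hj) (iff_of_true hi' hj') fun x => by
      have := hA1 x; have := hA2 x; have := hA x; omega
  · exact (hII' i' j' l' hij' hl' _ fun x => by
      rw [← hS2 x, ← hS x, hS1 x]).elim
  · exact (hIII i' j' l' hij' hl' (iff_of_false hi' hj') _ fun x => by
      rw [← hS2 x, ← hS x, hS1 x]).elim
  · exact (hII' i j l hij hl _ fun x => by rw [← hS1 x, hS x, hS2 x]).elim
  -- For two pairs of type II each block sees one replaced part. The order of the two parts fixes
  -- the direction of the move, so the new fermionic part determines the intensity.
  · obtain ⟨h1, h2⟩ := eq_of_indicator_single (q := Λ.parts i')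
      (q' := transfer Λ.parts i' j' l' i') hn.1 fun x => by
      have := hA1 x; have := hA2 x; have := hA x; omega
    obtain ⟨h3, -⟩ := eq_of_indicator_single (q := Λ.parts j')
      (q' := transfer Λ.parts i' j' l' j') hn.2 fun x => by
      have := hS1 x; have := hS2 x; have := hS x; omega
    refine ⟨h1, h3, ?_⟩
    unfold gap at hp hp'
    rw [transfer_left _ _ hij.ne, transfer_left _ _ hij'.ne] at h2
    split_ifs at h2 <;> omega
  · exact (hII i j l hij hl _ fun x => by rw [← hA1 x, hA x, hA2 x]).elim
  · exact (hIII i j l hij hl (iff_of_false hi hj) _ fun x => by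
      rw [← hS1 x, hS x, hS2 x]).elim
  · exact (hII i' j' l' hij' hl' _ fun x => by rw [← hA2 x, ← hA x, hA1 x]).elim
  · exact hpair (iff_of_false hi hj) (iff_of_false hi' hj') fun x => by
      have := hS1 x; have := hS2 x; have := hS x; omega

theorem transfer_apply (γ : Fin N → ℕ) {i j : Fin N} (hij : i ≠ j) (l : ℕ) (k : Fin N) :
    transfer γ i j l k = if k = j then (if γ j < γ i then γ j + l else γ j - l)
      else if k = i then (if γ j < γ i then γ i - l else γ i + l) else γ k := by
  by_cases hj : k = j
  · subst hj
    rw [if_pos rfl, transfer_right]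
  · by_cases hi : k = i
    · subst hi
      rw [if_neg hj, if_pos rfl, transfer_left _ _ hij]
    · rw [if_neg hj, if_neg hi, transfer_of_ne _ _ hi hj]

theorem parts_ne_of_mem_intensities {Λ : Superpartition N m} {i j : Fin N} {l : ℕ}
    (h : l ∈ intensities Λ i j) : Λ.parts i ≠ Λ.parts j := by
  have := pos_and_lt_gap h
  unfold gap at this
  omega

/-- Moving the same amount between equal parts in the same blocks gives sequences that differ
only by a permutation of the symmetric block. -/
theorem exists_transfer_eq_comp (Λ : Superpartition N m) {i j i' j' : Fin N} (hij : i < j)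
    (hij' : i' < j') (ht : pairType m i j = pairType m i' j') (hi : Λ.parts i = Λ.parts i')
    (hj : Λ.parts j = Λ.parts j') (hne : Λ.parts i ≠ Λ.parts j) (l : ℕ) :
    ∃ ρ : Equiv.Perm (Fin N), (∀ k : Fin N, (k : ℕ) < m → ρ k = k) ∧
      transfer Λ.parts i j l = transfer Λ.parts i' j' l ∘ ρ := by
  obtain ⟨hbi, hbj⟩ := (pairType_eq_iff hij hij').1 ht
  have hswap (p p' : Fin N) (hp : Λ.parts p = Λ.parts p') (hb : (p : ℕ) < m ↔ (p' : ℕ) < m)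
      (k : Fin N) (hk : (k : ℕ) < m) : Equiv.swap p p' k = k := by
    by_cases h : (p : ℕ) < m
    · rw [Λ.injOn h (hb.1 h) hp, Equiv.swap_self, Equiv.refl_apply]
    · exact Equiv.swap_apply_of_ne_of_ne (fun h' => h (h' ▸ hk)) (fun h' => h (hb.2 (h' ▸ hk)))
  have hparts (p p' : Fin N) (hp : Λ.parts p = Λ.parts p') (k : Fin N) :
      Λ.parts (Equiv.swap p p' k) = Λ.parts k := by
    rw [Equiv.swap_apply_def]
    split_ifs with h1 h2
    · rw [h1, hp]
    · rw [h2, hp]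
    · rfl
  -- Both swaps exchange equal parts within one block, so `ρ` preserves `Λ`; on the fermionic block
  -- they are trivial because parts there are distinct.
  set ρ := Equiv.swap i i' * Equiv.swap j j' with hρ
  have hΛ (k : Fin N) : Λ.parts (ρ k) = Λ.parts k := by
    rw [hρ, Equiv.Perm.mul_apply, hparts _ _ hi, hparts _ _ hj]
  have hρi : ρ i = i' := by
    rw [hρ, Equiv.Perm.mul_apply, Equiv.swap_apply_of_ne_of_ne hij.ne, Equiv.swap_apply_left]
    rintro rfl
    exact hne hj.symm
  have hρj : ρ j = j' := by
    rw [hρ, Equiv.Perm.mul_apply, Equiv.swap_apply_left, Equiv.swap_apply_of_ne_of_ne _ hij'.ne']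
    rintro rfl
    exact hne hj.symm
  refine ⟨ρ, fun k hk => ?_, funext fun k => ?_⟩
  · rw [hρ, Equiv.Perm.mul_apply, hswap j j' hj hbj k hk, hswap i i' hi hbi k hk]
  · rw [Function.comp_apply, transfer_apply _ hij.ne, transfer_apply _ hij'.ne, hΛ, hi, hj,
      ← hρi, ← hρj]
    simp only [ρ.injective.eq_iff]

theorem IsRearrangement.comp {γ : Fin N → ℕ} {Ω : Superpartition N m}
    {σa σs ρ : Equiv.Perm (Fin N)} (h : IsRearrangement γ Ω σa σs)
    (hρ : ∀ k : Fin N, (k : ℕ) < m → ρ k = k) : IsRearrangement (γ ∘ ρ) Ω σa (σs * ρ) where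
  fix_a := h.fix_a
  fix_s k hk := by rw [Equiv.Perm.mul_apply, hρ k hk, h.fix_s k hk]
  sends k := by
    rw [← mul_assoc, Equiv.Perm.mul_apply, h.sends (ρ k)]
    rfl

theorem IsRearrangement.countOn_lt {γ : Fin N → ℕ} {Ω : Superpartition N m}
    {σa σs : Equiv.Perm (Fin N)} (h : IsRearrangement γ Ω σa σs) (x : ℕ) :
    countOn (fun k : Fin N => (k : ℕ) < m) γ x =
      countOn (fun k : Fin N => (k : ℕ) < m) Ω.parts x := by
  rw [← h.comp_eq, countOn_comp _ _ _ h.lt_iff]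

theorem IsRearrangement.countOn_ge {γ : Fin N → ℕ} {Ω : Superpartition N m}
    {σa σs : Equiv.Perm (Fin N)} (h : IsRearrangement γ Ω σa σs) (x : ℕ) :
    countOn (fun k : Fin N => m ≤ (k : ℕ)) γ x = Ω.mult x := by
  rw [← h.comp_eq, countOn_comp _ _ _ fun k => by
    rw [← not_lt, h.lt_iff, not_lt]]
  rfl

theorem eq_of_isRearrangement_transfer {Λ Ω : Superpartition N m} {i j i' j' : Fin N} {l l' : ℕ}
    (hij : i < j) (hij' : i' < j') (hl : l ∈ intensities Λ i j) (hl' : l' ∈ intensities Λ i' j')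
    {σa σs σa' σs' : Equiv.Perm (Fin N)}
    (h : IsRearrangement (transfer Λ.parts i j l) Ω σa σs)
    (h' : IsRearrangement (transfer Λ.parts i' j' l') Ω σa' σs') :
    pairType m i j = pairType m i' j' ∧ Λ.parts i = Λ.parts i' ∧ Λ.parts j = Λ.parts j' ∧
      l = l' :=
  eq_of_countOn_transfer_eq hij hij' hl hl'
    (fun x => (h.countOn_lt x).trans (h'.countOn_lt x).symm)
    (fun x => (h.countOn_ge x).trans (h'.countOn_ge x).symm)

/-- The block containing `i` loses one part equal to `Λ.parts i` and gains none. -/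
theorem not_isRearrangement_transfer_self {Λ : Superpartition N m} {i j : Fin N} {l : ℕ}
    (hij : i < j) (hl : l ∈ intensities Λ i j) {σa σs : Equiv.Perm (Fin N)} :
    ¬ IsRearrangement (transfer Λ.parts i j l) Λ σa σs := by
  intro h
  have hn := transfer_ne hij hl
  have hA := countOn_transfer (fun k : Fin N => (k : ℕ) < m) Λ.parts hij.ne l (Λ.parts i)
  have hS := countOn_transfer (fun k : Fin N => m ≤ (k : ℕ)) Λ.parts hij.ne l (Λ.parts i)
  rw [h.countOn_lt] at hA
  rw [h.countOn_ge, show countOn (fun k : Fin N => m ≤ (k : ℕ)) Λ.parts (Λ.parts i) =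
    Λ.mult (Λ.parts i) from rfl] at hS
  have hne : ((i : ℕ) < m ↔ (j : ℕ) < m) → transfer Λ.parts i j l j ≠ Λ.parts i := fun hb => by
    have h1 := add_two_mul_le hij hb hl
    have h2 := (pos_and_lt_gap hl).1
    rw [(transfer_of_same_block hij hb hl).2]
    omega
  by_cases hi : (i : ℕ) < m
  · by_cases hj : (j : ℕ) < m
    · simp only [hi, hj, true_and, if_true, hn.1.symm, hne (iff_of_true hi hj), if_false] at hA
      omega
    · simp only [hi, hj, true_and, false_and, if_true, hn.1.symm, if_false] at hA
      omega
  · have hj : ¬ (j : ℕ) < m := fun h' => hi (lt_trans (show (i : ℕ) < j from hij) h')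
    simp only [not_lt.1 hi, not_lt.1 hj, true_and, if_true, hn.1.symm,
      hne (iff_of_false hi hj), if_false] at hS
    omega

/-- With `d` the gap and `l > 0`, the floor conditions read `2 l < d`, `l < d` and `2 l ≤ d` for
types I, II and III. -/
theorem admissible_iff (Λ : Superpartition N m) {i j : Fin N} (hij : i < j) {l : ℕ} (hl : 0 < l) :
    (pairType m i j).Admissible (Λ.parts i) (Λ.parts j) l ↔ l ∈ intensities Λ i j := by
  have hv : (i : ℕ) < j := hij
  unfold intensities pairType
  by_cases hj : (j : ℕ) < m
  · have := Λ.anti i j hij hj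
    have hg : gap Λ.parts i j = Λ.parts i - Λ.parts j := by unfold gap; omega
    simp only [if_pos hj, PairType.Admissible, Finset.mem_filter, Finset.mem_Ioo, hg]
    omega
  · by_cases hi : (i : ℕ) < m
    · simp only [if_neg hj, if_pos hi, PairType.Admissible, Finset.mem_Ioo, gap]
      rcases abs_cases ((Λ.parts i : ℤ) - Λ.parts j) with ⟨h, h'⟩ | ⟨h, h'⟩ <;> rw [h] <;> omega
    · have := Λ.symm i j (not_lt.1 hi) hij.le
      have hg : gap Λ.parts i j = Λ.parts i - Λ.parts j := by unfold gap; omega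
      simp only [if_neg hj, if_neg hi, PairType.Admissible, Finset.mem_filter, Finset.mem_Ioo, hg]
      omega

theorem lowering_of_mem {Λ : Superpartition N m} {i j : Fin N} {l : ℕ} (hij : i < j)
    (h : l ∈ intensities Λ i j) : lowering i j l Λ = some (transfer Λ.parts i j l) := by
  have hne := parts_ne_of_mem_intensities h
  rw [lowering, if_pos ((admissible_iff Λ hij (pos_and_lt_gap h).1).2 h), transfer]
  split_ifs
  · rfl
  · rfl
  · omega

theorem mem_intensities_of_lowering {Λ : Superpartition N m} {i j : Fin N} {l : ℕ} (hij : i < j)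
    (hl : 0 < l) {γ : Fin N → ℕ} (h : lowering i j l Λ = some γ) :
    l ∈ intensities Λ i j ∧ γ = transfer Λ.parts i j l := by
  have hmem : l ∈ intensities Λ i j := by
    rw [← admissible_iff Λ hij hl]
    by_contra hn
    rw [lowering, if_neg hn] at h
    exact absurd h (by simp)
  rw [lowering_of_mem hij hmem] at h
  exact ⟨hmem, (Option.some.inj h).symm⟩

end Counting

/-! ### Multiplicities, normalisations and the closed form of the coefficients -/

section Coefficients

variable {𝕜 : Type*} [Field 𝕜] {N m : ℕ}

theorem prod_factorial_add_single (T : Finset ℕ) (n : ℕ → ℕ) {b : ℕ} (hb : b ∈ T) :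
    ∏ x ∈ T, (n x + if b = x then 1 else 0).factorial =
      (∏ x ∈ T, (n x).factorial) * (n b + 1) := by
  have h (x : ℕ) : (n x + if b = x then 1 else 0).factorial =
      (n x).factorial * if b = x then n x + 1 else 1 := by
    split_ifs
    · rw [Nat.factorial_succ, mul_comm]
    · simp
  simp only [h, Finset.prod_mul_distrib, Finset.prod_ite_eq, hb, if_true]

/-- Values outside the parts contribute `0! = 1`; this allows one index set for both `Λ` and `Ω`. -/
theorem Superpartition.norm_eq_prod (Λ : Superpartition N m) {T : Finset ℕ}
    (hT : ∀ k, Λ.parts k ∈ T) : Λ.norm = ∏ x ∈ T, (Λ.mult x).factorial := by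
  refine Finset.prod_subset (Finset.image_subset_iff.2 fun k _ => hT k) fun x _ hx => ?_
  have : Λ.mult x = 0 := by
    rw [Superpartition.mult, Finset.card_eq_zero, Finset.filter_eq_empty_iff]
    rintro k - ⟨-, hk⟩
    exact hx (Finset.mem_image.2 ⟨k, Finset.mem_univ k, hk⟩)
  rw [this, Nat.factorial_zero]

theorem Superpartition.mult_pos (Λ : Superpartition N m) {k : Fin N} (hk : m ≤ (k : ℕ)) :
    0 < Λ.mult (Λ.parts k) :=
  Finset.card_pos.2 ⟨k, by simp [hk]⟩

/-- Both multiplicity functions arise from a common `n₀` by adding one part, which multiplies the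
product of factorials by the new multiplicity of that part. -/
theorem prod_factorial_exchange (T : Finset ℕ) {n n' : ℕ → ℕ} {b b' : ℕ} (hb : b ∈ T)
    (hb' : b' ∈ T) (hpos : 0 < n b)
    (h : ∀ x, n' x + (if b = x then 1 else 0) = n x + if b' = x then 1 else 0) :
    (∏ x ∈ T, (n' x).factorial) * n b = (∏ x ∈ T, (n x).factorial) * n' b' := by
  set n₀ : ℕ → ℕ := fun x => n x - if b = x then 1 else 0 with hn₀
  have h1 (x : ℕ) : n x = n₀ x + if b = x then 1 else 0 := by
    simp only [hn₀]
    split_ifs with hx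
    · subst hx; omega
    · omega
  have h2 (x : ℕ) : n' x = n₀ x + if b' = x then 1 else 0 := by
    have := h x
    have := h1 x
    omega
  have e1 : n b = n₀ b + 1 := by rw [h1 b, if_pos rfl]
  have e2 : n' b' = n₀ b' + 1 := by rw [h2 b', if_pos rfl]
  rw [e1, e2, Finset.prod_congr rfl fun x _ => congrArg Nat.factorial (h1 x),
    Finset.prod_congr rfl fun x _ => congrArg Nat.factorial (h2 x),
    prod_factorial_add_single T n₀ hb, prod_factorial_add_single T n₀ hb']
  ring

/-- As in `prod_factorial_exchange`, with two parts added to `n₀`. If the new parts coincide, the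
two insertions contribute `n' a' * (n' a' - 1)`. -/
theorem prod_factorial_exchange_two (T : Finset ℕ) {n n' : ℕ → ℕ} {a b a' b' : ℕ} (ha : a ∈ T)
    (hb : b ∈ T) (ha' : a' ∈ T) (hb' : b' ∈ T) (hab : a ≠ b) (hpa : 0 < n a) (hpb : 0 < n b)
    (h : ∀ x, n' x + (if a = x then 1 else 0) + (if b = x then 1 else 0) =
      n x + (if a' = x then 1 else 0) + if b' = x then 1 else 0) :
    (∏ x ∈ T, (n' x).factorial) * (n a * n b) =
      (∏ x ∈ T, (n x).factorial) * if a' = b' then n' a' * (n' a' - 1) else n' a' * n' b' := by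
  set n₀ : ℕ → ℕ := fun x => n x - (if a = x then 1 else 0) - if b = x then 1 else 0 with hn₀
  have h1 (x : ℕ) : n x = n₀ x + (if a = x then 1 else 0) + if b = x then 1 else 0 := by
    simp only [hn₀]
    split_ifs with hx hy hy
    · omega
    · subst hx; omega
    · subst hy; omega
    · omega
  have h2 (x : ℕ) : n' x = n₀ x + (if a' = x then 1 else 0) + if b' = x then 1 else 0 := by
    have := h x
    have := h1 x
    omega
  have e1 : n a = n₀ a + 1 := by rw [h1 a, if_pos rfl, if_neg hab.symm]
  have e2 : n b = n₀ b + 1 := by rw [h1 b, if_pos rfl, if_neg hab]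
  rw [e1, e2, Finset.prod_congr rfl fun x _ => congrArg Nat.factorial (h1 x),
    Finset.prod_congr rfl fun x _ => congrArg Nat.factorial (h2 x),
    prod_factorial_add_single T (fun x => n₀ x + if a = x then 1 else 0) hb,
    prod_factorial_add_single T (fun x => n₀ x + if a' = x then 1 else 0) hb',
    prod_factorial_add_single T n₀ ha, prod_factorial_add_single T n₀ ha', if_neg hab]
  have e3 := h2 a'
  have e4 := h2 b'
  rw [if_pos rfl] at e3
  by_cases hab' : a' = b'
  · rw [if_pos hab'.symm] at e3
    rw [if_pos hab', if_pos hab', e3, ← hab']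
    simp only [Nat.add_sub_cancel]
    ring
  · rw [if_neg (Ne.symm hab')] at e3
    rw [if_pos rfl, if_neg hab'] at e4
    rw [if_neg hab', if_neg hab', e3, e4]
    ring

/-- The positions in the same block as `i` that carry the same part. -/
def likePositions (Λ : Superpartition N m) (i : Fin N) : Finset (Fin N) :=
  Finset.univ.filter fun k => ((k : ℕ) < m ↔ (i : ℕ) < m) ∧ Λ.parts k = Λ.parts i

theorem card_likePositions_of_lt (Λ : Superpartition N m) {i : Fin N} (hi : (i : ℕ) < m) :
    (likePositions Λ i).card = 1 := by
  rw [Finset.card_eq_one]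
  refine ⟨i, ?_⟩
  ext k
  simp only [likePositions, Finset.mem_filter, Finset.mem_univ, true_and, Finset.mem_singleton]
  constructor
  · rintro ⟨h1, h2⟩
    exact Λ.injOn (h1.2 hi) hi h2
  · rintro rfl
    exact ⟨Iff.rfl, rfl⟩

theorem card_likePositions_of_ge (Λ : Superpartition N m) {i : Fin N} (hi : m ≤ (i : ℕ)) :
    (likePositions Λ i).card = Λ.mult (Λ.parts i) := by
  unfold likePositions Superpartition.mult
  congr 1
  ext k
  simp only [Finset.mem_filter, Finset.mem_univ, true_and, ← not_le, hi, not_true, iff_false,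
    not_not]

/-- Weakly decreasing order puts all positions of the larger symmetric part before those of the
smaller, so `i < j` is automatic and the contributing pairs form a full product. -/
theorem lt_and_pairType_eq_iff (Λ : Superpartition N m) {i j i₀ j₀ : Fin N} (h₀ : i₀ < j₀)
    (hne : Λ.parts i₀ ≠ Λ.parts j₀) :
    (i < j ∧ pairType m i j = pairType m i₀ j₀ ∧ Λ.parts i = Λ.parts i₀ ∧
      Λ.parts j = Λ.parts j₀) ↔ i ∈ likePositions Λ i₀ ∧ j ∈ likePositions Λ j₀ := by
  have hv₀ : (i₀ : ℕ) < j₀ := h₀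
  simp only [likePositions, Finset.mem_filter, Finset.mem_univ, true_and]
  constructor
  · rintro ⟨hij, ht, hi, hj⟩
    obtain ⟨h1, h2⟩ := (pairType_eq_iff hij h₀).1 ht
    exact ⟨⟨h1, hi⟩, ⟨h2, hj⟩⟩
  · rintro ⟨⟨h1, hi⟩, ⟨h2, hj⟩⟩
    have hij : i < j := by
      by_cases hj₀ : (j₀ : ℕ) < m
      · have hi₀ : (i₀ : ℕ) < m := hv₀.trans hj₀
        rw [Λ.injOn (h1.2 hi₀) hi₀ hi, Λ.injOn (h2.2 hj₀) hj₀ hj]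
        exact h₀
      · by_cases hi₀ : (i₀ : ℕ) < m
        · have := h1.2 hi₀
          have := mt h2.1 hj₀
          exact show (i : ℕ) < j by omega
        · have h3 := Λ.symm i₀ j₀ (not_lt.1 hi₀) h₀.le
          have h4 : m ≤ (j : ℕ) := not_lt.1 (mt h2.1 hj₀)
          by_contra hle
          have h5 := Λ.symm j i h4 (not_lt.1 hle)
          omega
    exact ⟨hij, (pairType_eq_iff hij h₀).2 ⟨h1, h2⟩, hi, hj⟩

theorem sum_ite_lowering {A : Type*} [AddCommMonoid A] (Λ : Superpartition N m) {i₀ j₀ : Fin N}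
    (h₀ : i₀ < j₀) (hne : Λ.parts i₀ ≠ Λ.parts j₀) (c : A) :
    ∑ i, ∑ j ∈ Finset.Ioi i, (if i ∈ likePositions Λ i₀ ∧ j ∈ likePositions Λ j₀ then c else 0) =
      ((likePositions Λ i₀).card * (likePositions Λ j₀).card) • c := by
  have h1 (i : Fin N) : ∑ j ∈ Finset.Ioi i,
      (if i ∈ likePositions Λ i₀ ∧ j ∈ likePositions Λ j₀ then c else 0) =
      ∑ j, if i ∈ likePositions Λ i₀ ∧ j ∈ likePositions Λ j₀ then c else 0 := by
    refine Finset.sum_subset (Finset.subset_univ _) fun j _ hj => if_neg fun h => hj ?_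
    exact Finset.mem_Ioi.2 ((lt_and_pairType_eq_iff Λ h₀ hne).2 h).1
  simp only [h1]
  rw [← Finset.sum_product', ← Finset.sum_filter, Finset.sum_const, ← Finset.card_product]
  congr 2
  ext p
  simp

/-- Only pairs with the same parts and blocks, at intensity `l₀`, reach `Ω`. Their sequences differ
by a permutation of the symmetric block, so all contribute the same signed amount. -/
theorem offDiagonal_apply (β : 𝕜) {Λ Ω : Superpartition N m} {i₀ j₀ : Fin N} {l₀ : ℕ}
    (h₀ : i₀ < j₀) (hl₀ : l₀ ∈ intensities Λ i₀ j₀) {σa σs : Equiv.Perm (Fin N)}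
    (h : IsRearrangement (transfer Λ.parts i₀ j₀ l₀) Ω σa σs) :
    offDiagonal β Λ Ω = 2 * β * (Λ.norm : 𝕜)⁻¹ *
      (((likePositions Λ i₀).card * (likePositions Λ j₀).card : ℕ) *
        ((pairType m i₀ j₀).weight 𝕜 (gap Λ.parts i₀ j₀) l₀ *
          (((Equiv.Perm.sign σa : ℤ) : 𝕜) * Ω.norm))) := by
  have hne := parts_ne_of_mem_intensities hl₀
  have key (i j : Fin N) (hij : i < j) :
      ∑ l ∈ intensities Λ i j, (pairType m i j).weight 𝕜 (gap Λ.parts i j) l *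
        orbitCoeff 𝕜 m (transfer Λ.parts i j l) Ω =
      if i ∈ likePositions Λ i₀ ∧ j ∈ likePositions Λ j₀ then
        (pairType m i₀ j₀).weight 𝕜 (gap Λ.parts i₀ j₀) l₀ *
          (((Equiv.Perm.sign σa : ℤ) : 𝕜) * Ω.norm) else 0 := by
    have hzero (l : ℕ) (hl : l ∈ intensities Λ i j)
        (hn : orbitCoeff 𝕜 m (transfer Λ.parts i j l) Ω ≠ 0) :
        (i ∈ likePositions Λ i₀ ∧ j ∈ likePositions Λ j₀) ∧ l = l₀ := by
      obtain ⟨σa', σs', h'⟩ := exists_isRearrangement_of_orbitCoeff_ne_zero hn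
      obtain ⟨h1, h2, h3, h4⟩ := eq_of_isRearrangement_transfer hij h₀ hl hl₀ h' h
      exact ⟨(lt_and_pairType_eq_iff Λ h₀ hne).1 ⟨hij, h1, h2, h3⟩, h4⟩
    split_ifs with hC
    · obtain ⟨-, ht, hi, hj⟩ := (lt_and_pairType_eq_iff Λ h₀ hne).2 hC
      have hg : gap Λ.parts i j = gap Λ.parts i₀ j₀ := by unfold gap; rw [hi, hj]
      have hI : intensities Λ i j = intensities Λ i₀ j₀ := by
        unfold intensities; rw [ht, hg]
      obtain ⟨ρ, hρ, hT⟩ := exists_transfer_eq_comp Λ hij h₀ ht hi hj (by rwa [hi, hj]) l₀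
      rw [Finset.sum_eq_single_of_mem l₀ (hI ▸ hl₀)]
      · rw [ht, hg, hT, (h.comp hρ).orbitCoeff_eq, Finsupp.single_eq_same]
      · intro l hl hll
        by_contra hn
        exact hll (hzero l hl (right_ne_zero_of_mul hn)).2
    · refine Finset.sum_eq_zero fun l hl => ?_
      by_contra hn
      exact hC (hzero l hl (right_ne_zero_of_mul hn)).1
  simp only [offDiagonal, Finsupp.smul_apply, Finsupp.finsetSum_apply, smul_eq_mul]
  rw [Finset.sum_congr rfl fun i _ => Finset.sum_congr rfl fun j hj =>
    key i j (Finset.mem_Ioi.1 hj), sum_ite_lowering Λ h₀ hne, nsmul_eq_mul]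

/-- The number of contributing pairs is expressed by multiplicities of `Λ`; the ratio of the two
normalisations replaces them by multiplicities of `Ω`. -/
theorem weight_mul_norm [CharZero 𝕜] {Λ Ω : Superpartition N m} {i j : Fin N} {l : ℕ}
    (hij : i < j) (hl : l ∈ intensities Λ i j) {σa σs : Equiv.Perm (Fin N)}
    (h : IsRearrangement (transfer Λ.parts i j l) Ω σa σs) :
    (((likePositions Λ i).card * (likePositions Λ j).card : ℕ) : 𝕜) *
        ((pairType m i j).weight 𝕜 (gap Λ.parts i j) l * Ω.norm) =
      Λ.norm * (((gap Λ.parts i j : 𝕜) - (pairType m i j).delta * l) *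
        symmetryFactor 𝕜 Ω (transfer Λ.parts i j l i) (transfer Λ.parts i j l j)
          (pairType m i j)) := by
  have hv : (i : ℕ) < j := hij
  have hS (x : ℕ) : Ω.mult x + (if m ≤ (i : ℕ) ∧ Λ.parts i = x then 1 else 0) +
        (if m ≤ (j : ℕ) ∧ Λ.parts j = x then 1 else 0) =
      Λ.mult x + (if m ≤ (i : ℕ) ∧ transfer Λ.parts i j l i = x then 1 else 0) +
        (if m ≤ (j : ℕ) ∧ transfer Λ.parts i j l j = x then 1 else 0) := by
    rw [← h.countOn_ge x]
    exact countOn_transfer (fun k : Fin N => m ≤ (k : ℕ)) Λ.parts hij.ne l x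
  set T : Finset ℕ := Finset.univ.image Λ.parts ∪ Finset.univ.image (transfer Λ.parts i j l)
    with hT
  have hΛT (k : Fin N) : Λ.parts k ∈ T :=
    Finset.mem_union_left _ (Finset.mem_image_of_mem _ (Finset.mem_univ k))
  have hγT (k : Fin N) : transfer Λ.parts i j l k ∈ T :=
    Finset.mem_union_right _ (Finset.mem_image_of_mem _ (Finset.mem_univ k))
  have hΩT (k : Fin N) : Ω.parts k ∈ T := by
    obtain ⟨k, rfl⟩ := (σa * σs).surjective k
    rw [h.sends k]
    exact hγT k
  have hΛn := Λ.norm_eq_prod hΛT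
  have hΩn := Ω.norm_eq_prod hΩT
  have hn := transfer_ne hij hl
  by_cases hj : (j : ℕ) < m
  · have hi : (i : ℕ) < m := hv.trans hj
    have ht : pairType m i j = .I := if_pos hj
    have hmult (x : ℕ) : Ω.mult x = Λ.mult x := by
      have := hS x
      rw [if_neg (fun h => absurd h.1 hi.not_ge), if_neg (fun h => absurd h.1 hj.not_ge),
        if_neg (fun h => absurd h.1 hi.not_ge), if_neg (fun h => absurd h.1 hj.not_ge)] at this
      exact this
    have hnorm : Ω.norm = Λ.norm := by
      rw [hΛn, hΩn]
      simp only [hmult]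
    rw [card_likePositions_of_lt Λ hi, card_likePositions_of_lt Λ hj, ht, hnorm]
    simp only [PairType.weight, PairType.delta, symmetryFactor]
    push_cast
    ring
  · by_cases hi : (i : ℕ) < m
    · have ht : pairType m i j = .II := by rw [pairType, if_neg hj, if_pos hi]
      have := prod_factorial_exchange T (n := Λ.mult) (n' := Ω.mult) (hΛT j) (hγT j)
        (Λ.mult_pos (not_lt.1 hj)) fun x => by
          have := hS x
          simp only [hi.not_ge, not_lt.1 hj, false_and, true_and, if_false, add_zero] at this
          exact this
      rw [← hΛn, ← hΩn] at this
      have hc : (Ω.norm : 𝕜) * Λ.mult (Λ.parts j) =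
          Λ.norm * Ω.mult (transfer Λ.parts i j l j) := mod_cast this
      rw [card_likePositions_of_lt Λ hi, card_likePositions_of_ge Λ (not_lt.1 hj), ht]
      simp only [PairType.weight, PairType.delta, symmetryFactor]
      push_cast
      linear_combination ((gap Λ.parts i j : 𝕜) - l) * hc
    · have ht : pairType m i j = .III := by rw [pairType, if_neg hj, if_neg hi]
      have hb : (i : ℕ) < m ↔ (j : ℕ) < m := iff_of_false hi hj
      have := prod_factorial_exchange_two T (n := Λ.mult) (n' := Ω.mult) (hΛT i) (hΛT j)
        (hγT i) (hγT j) (parts_ne_of_mem_intensities hl) (Λ.mult_pos (not_lt.1 hi))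
        (Λ.mult_pos (not_lt.1 hj)) fun x => by
          have := hS x
          simp only [not_lt.1 hi, not_lt.1 hj, true_and] at this
          exact this
      rw [← hΛn, ← hΩn] at this
      -- The midpoint, which carries the half weight, is exactly the case `a = b` of the symmetry
      -- factor.
      have hhalf : 2 * l = gap Λ.parts i j ↔
          transfer Λ.parts i j l i = transfer Λ.parts i j l j := by
        have h1 := add_two_mul_le hij hb hl
        rw [(transfer_of_same_block hij hb hl).1, (transfer_of_same_block hij hb hl).2]
        unfold gap
        omega
      rw [card_likePositions_of_ge Λ (not_lt.1 hi), card_likePositions_of_ge Λ (not_lt.1 hj), ht]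
      simp only [PairType.weight, PairType.delta, symmetryFactor, hhalf]
      split_ifs at this ⊢ with he
      -- Positivity makes the cast of the natural number `n - 1` agree with subtraction in the
      -- field.
      · have hpos : 1 ≤ Ω.mult (transfer Λ.parts i j l i) := by
          have := hS (transfer Λ.parts i j l i)
          simp only [not_lt.1 hi, not_lt.1 hj, true_and, if_true, hn.1, if_false,
            he ▸ hn.2] at this
          omega
        have hc : (Ω.norm : 𝕜) * (Λ.mult (Λ.parts i) * Λ.mult (Λ.parts j)) =
            Λ.norm * (Ω.mult (transfer Λ.parts i j l i) *
              ((Ω.mult (transfer Λ.parts i j l i) : 𝕜) - 1)) := by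
          have := congrArg (Nat.cast : ℕ → 𝕜) this
          push_cast [Nat.cast_sub hpos] at this
          exact this
        push_cast
        linear_combination (gap Λ.parts i j : 𝕜) * (1 / 2) * hc
      · have hc : (Ω.norm : 𝕜) * (Λ.mult (Λ.parts i) * Λ.mult (Λ.parts j)) =
            Λ.norm * (Ω.mult (transfer Λ.parts i j l i) *
              Ω.mult (transfer Λ.parts i j l j)) := mod_cast this
        push_cast
        linear_combination (gap Λ.parts i j : 𝕜) * hc

theorem offDiagonal_eq [CharZero 𝕜] (β : 𝕜) {Λ Ω : Superpartition N m} {i j : Fin N} {l : ℕ}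
    (hij : i < j) (hl : l ∈ intensities Λ i j) {σa σs : Equiv.Perm (Fin N)}
    (h : IsRearrangement (transfer Λ.parts i j l) Ω σa σs) :
    offDiagonal β Λ Ω = 2 * β * ((Equiv.Perm.sign σa : ℤ) : 𝕜) *
      ((gap Λ.parts i j : 𝕜) - (pairType m i j).delta * l) *
        symmetryFactor 𝕜 Ω (transfer Λ.parts i j l i) (transfer Λ.parts i j l j)
          (pairType m i j) := by
  have hn : (Λ.norm : 𝕜) ≠ 0 := by
    rw [Nat.cast_ne_zero, Superpartition.norm, Finset.prod_ne_zero_iff]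
    exact fun a _ => Nat.factorial_ne_zero _
  have hw := weight_mul_norm (𝕜 := 𝕜) hij hl h
  rw [offDiagonal_apply β hij hl h]
  have hi : (Λ.norm : 𝕜)⁻¹ * Λ.norm = 1 := inv_mul_cancel₀ hn
  linear_combination 2 * β * (Λ.norm : 𝕜)⁻¹ * ((Equiv.Perm.sign σa : ℤ) : 𝕜) * hw +
    2 * β * ((Equiv.Perm.sign σa : ℤ) : 𝕜) *
      (((gap Λ.parts i j : 𝕜) - (pairType m i j).delta * l) *
        symmetryFactor 𝕜 Ω (transfer Λ.parts i j l i) (transfer Λ.parts i j l j)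
          (pairType m i j)) * hi

theorem exists_lowering_of_offDiagonal_ne_zero (β : 𝕜) {Λ Ω : Superpartition N m}
    (h : offDiagonal β Λ Ω ≠ 0) :
    ∃ (i j : Fin N) (l : ℕ) (σa σs : Equiv.Perm (Fin N)), i < j ∧ l ∈ intensities Λ i j ∧
      IsRearrangement (transfer Λ.parts i j l) Ω σa σs := by
  simp only [offDiagonal, Finsupp.smul_apply, Finsupp.finsetSum_apply, smul_eq_mul] at h
  obtain ⟨i, -, hi⟩ := Finset.exists_ne_zero_of_sum_ne_zero (right_ne_zero_of_mul h)
  obtain ⟨j, hj, hij⟩ := Finset.exists_ne_zero_of_sum_ne_zero hi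
  obtain ⟨l, hl, hijl⟩ := Finset.exists_ne_zero_of_sum_ne_zero hij
  obtain ⟨σa, σs, hr⟩ :=
    exists_isRearrangement_of_orbitCoeff_ne_zero (right_ne_zero_of_mul hijl)
  exact ⟨i, j, l, σa, σs, Finset.mem_Ioi.1 hj, hl, hr⟩

end Coefficients

end SuperCMS

end

/-! ### The action of the Hamiltonian on monomial superfunctions -/

open SuperCMS in
theorem theorem2 {𝕜 : Type*} [Field 𝕜] [CharZero 𝕜] (N m : ℕ) (β : 𝕜)
    (Λ : Superpartition N m) :
    ∃ v : Superpartition N m →₀ 𝕜,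
      hamiltonian β (Λ.monomial 𝕜) =
          Λ.eigenvalue β • Λ.monomial 𝕜 + v.sum (fun Ω c => c • Ω.monomial 𝕜) ∧
      v Λ = 0 ∧
      (∀ Ω : Superpartition N m, v Ω ≠ 0 →
        ∃ (i j : Fin N) (ℓ : ℕ) (σa σs : Equiv.Perm (Fin N)),
          0 < ℓ ∧ IsLowering Λ Ω i j ℓ σa σs) ∧
      (∀ (Ω : Superpartition N m) (i j : Fin N) (ℓ : ℕ) (σa σs : Equiv.Perm (Fin N)),
        0 < ℓ → IsLowering Λ Ω i j ℓ σa σs →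
          (Λ.parts j < Λ.parts i →
            v Ω = 2 * β * ((Equiv.Perm.sign σa : ℤ) : 𝕜) *
              ((Λ.parts i : 𝕜) - Λ.parts j - ((pairType m i j).delta : 𝕜) * ℓ) *
              symmetryFactor 𝕜 Ω (Λ.parts i - ℓ) (Λ.parts j + ℓ) (pairType m i j)) ∧
          (Λ.parts i < Λ.parts j →
            v Ω = 2 * β * ((Equiv.Perm.sign σa : ℤ) : 𝕜) *
              ((Λ.parts j : 𝕜) - Λ.parts i - ((pairType m i j).delta : 𝕜) * ℓ) *
              symmetryFactor 𝕜 Ω (Λ.parts i + ℓ) (Λ.parts j - ℓ) (pairType m i j))) := by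
  refine ⟨offDiagonal β Λ, hamiltonian_monomial β Λ, ?_, ?_, ?_⟩
  · by_contra h
    obtain ⟨i, j, l, σa, σs, hij, hl, hr⟩ := exists_lowering_of_offDiagonal_ne_zero β h
    exact not_isRearrangement_transfer_self hij hl hr
  · intro Ω h
    obtain ⟨i, j, l, σa, σs, hij, hl, hr⟩ := exists_lowering_of_offDiagonal_ne_zero β h
    exact ⟨i, j, l, σa, σs, (pos_and_lt_gap hl).1, hij, _, lowering_of_mem hij hl, hr⟩
  · intro Ω i j l σa σs hpos hlow
    obtain ⟨γ, hγ, hr⟩ := hlow.exists_eq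
    have hij := hlow.lt
    obtain ⟨hl, rfl⟩ := mem_intensities_of_lowering hij hpos hγ
    have hv := offDiagonal_eq (𝕜 := 𝕜) β hij hl hr
    rw [transfer_left _ _ hij.ne, transfer_right] at hv
    constructor
    · intro hlt
      have hg : gap Λ.parts i j = Λ.parts i - Λ.parts j := by unfold gap; omega
      rw [if_pos hlt, if_pos hlt, hg, Nat.cast_sub hlt.le] at hv
      exact hv
    · intro hlt
      have hg : gap Λ.parts i j = Λ.parts j - Λ.parts i := by unfold gap; omega
      rw [if_neg hlt.not_gt, if_neg hlt.not_gt, hg, Nat.cast_sub hlt.le] at hv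
      exact hv
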